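/- **Setting (confined multisystems).** A confined multisystem consists of a finite-dimensional Hilbert space, a density matrix $\rho$, commuting self-adjoint operators $\bm E=(H_1,\dots,H_\ell)$ and a self-adjoint operator $V$. Put $H=\sum_j H_j+V$. Let $\operatorname{sp}\bm E=\prod_j\operatorname{sp}H_j$, let $P_{\bm e}$ ($\bm e\in\operatorname{sp}\bm E$) be the joint spectral projections, and $\tilde\rho=\sum_{\bm e}P_{\bm e}\rho P_{\bm e}$. For $t>0$ let $\mathbb P_t$ be the law on $\mathbb R^\ell$ of $\bm\phi=(\bm e'-\bm e)/t$, where $(\bm e,\bm e')$ has probability $\mathrm{tr}(e^{-itH}\tilde\rho P_{\bm e}e^{itH}P_{\bm e'})$; let $\mathbb P_0=\delta_0$. For $\bm\alpha\in\mathbb C^\ell$ let $\chi_t(\bm\alpha)=\int e^{-t\,\bm\alpha\cdot\bm\varphi}\,d\mathbb P_t(\bm\varphi)$ with $\bm\alpha\cdot\bm\varphi=\sum_j\alpha_j\varphi_j$. For $\bm\alpha\in\mathbb R^\ell$ let $V_{\bm\alpha}=e^{\frac12\bm\alpha\cdot\bm E}\,V\,e^{-\frac12\bm\alpha\cdot\bm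 E}$ and, with $\bm 1=(1,\dots,1)$, $$S(\alpha_0,\theta_0)=\sup\Big\{\|V_{\bm\alpha+\theta\bm 1}\| : |\theta|\le\theta_0,\ \bm\alpha\in\mathbb R^\ell,\ \sum_j\alpha_j=0,\ \max_j|\alpha_j|<\alpha_0\Big\}.$$ For a family of confined multisystems indexed by $L\in\mathbb N$ (with $\ell$ fixed), quantities of the $L$-th one carrying the superscript $(L)$, consider: * **TL**: for all $t\ge0$ and $\bm\alpha\in i\mathbb R^\ell$ the limit $\chi_t(\bm\alpha)=\lim_{L\to\infty}\chi^{(L)}_t(\bm\alpha)$ exists and is finite, and for every $t\ge0$ the map $i\mathbb R^\ell\ni\bm\alpha\mapsto\chi_t(\bm\alpha)$ is continuous at $0$. * **B$(\alpha_0,\theta_0)$**, for $\alpha_0>0$ and $\theta_0\ge\alpha_0$: $\sup_L S^{(L)}(\alpha_0,\theta_0)<\infty$. **The model.** Let $k\ge1$, let $\mathbb Z^d=\mathcal G_1\cup\dots\cup\mathcal G_\ell$ be a partition into infinite sets, and let $\partial\mathcal G_j$ be the set of the $x\in\mathcal G_j$ with at least one nearest neighbour outside $\mathcal G_j$. Let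 $S$ be a self-adjoint operator on $(\mathbb C^k)^{\otimes(2d+1)}$ and, for $x\in\mathbb Z^d$, let $S_x$ be the copy of $S$ that acts on $x$ and its $2d$ nearest neighbours, a copy of $\mathbb C^k$ being attached to every site. Let $J$ be a real function with $\sum_{x\in\bigcup_j\partial\mathcal G_j}|J(x)|<\infty$, and let $\bm\beta\in(0,\infty)^\ell$. For $L\in\mathbb N$ let $\mathcal G^{(L)}=\{-L,\dots,L\}^d$, let $\Lambda_L$ be the set of the sites of $\mathcal G^{(L)}$ and their nearest neighbours, and on $\bigotimes_{y\in\Lambda_L}\mathbb C^k$ put $$H_j^{(L)}=\sum_{x\in\mathcal G^{(L)}\cap(\mathcal G_j\setminus\partial\mathcal G_j)}S_x,\qquad V^{(L)}=\sum_{x\in\mathcal G^{(L)}\cap\bigcup_j\partial\mathcal G_j}J(x)\,S_x,\qquad \rho^{(L)}=\frac{e^{-\sum_j\beta_jH_j^{(L)}}}{\mathrm{tr}\,e^{-\sum_j\beta_jH_j^{(L)}}}.$$ Let $\mathcal O$ be the quasi-local algebra, the norm completion of the union of the algebras $\bigotimes_{x\in X}M_k(\mathbb C)$, $X\subset\mathbb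 Z^d$ finite (under the embeddings $A\mapsto A\otimes1$). **Theorem.** Suppose that $\lim_{L\to\infty}\mathrm{tr}(\rho^{(L)}A)$ exists for every $A\in\mathcal O$, in the sense that $\lim_{L\to\infty}\mathrm{tr}(\rho^{(L)}A_L)$ exists for every sequence of operators $A_L$ on $\bigotimes_{y\in\Lambda_L}\mathbb C^k$ that converges in norm to an element $A$ of $\mathcal O$. Then TL holds for the family $(\rho^{(L)},\bm E^{(L)},V^{(L)})_{L\in\mathbb N}$, where $\bm E^{(L)}=(H_1^{(L)},\dots,H_\ell^{(L)})$, and there is $\gamma>0$ such that B$(\alpha_0,\theta_0)$ holds whenever $0<\alpha_0\le\theta_0<\gamma$. -/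

import Mathlib

open scoped Matrix.Norms.L2Operator ComplexOrder ENNReal Topology

namespace OpenSpin

noncomputable section

/-! ### Confined multisystems and two-time measurements

A finite-dimensional Hilbert space with a chosen orthonormal basis indexed by `n` is
`EuclideanSpace ℂ n`; its operators are the matrices `Matrix n n ℂ`, and `‖·‖` is the operator
norm on them. -/

/-- A confined multisystem with `ℓ` reservoirs: a density matrix `ρ`, commuting observables
`E 0, …, E (ℓ - 1)` (the energies `H_j` of the reservoirs), and a further observable `V`. -/
structure ConfinedMultisystem (ℓ : ℕ) (n : Type) [Fintype n] [DecidableEq n] where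
  ρ : Matrix n n ℂ
  E : Fin ℓ → Matrix n n ℂ
  V : Matrix n n ℂ
  ρ_posSemidef : ρ.PosSemidef
  ρ_trace : ρ.trace = 1
  E_hermitian : ∀ j, (E j).IsHermitian
  E_commute : ∀ i j, Commute (E i) (E j)
  V_hermitian : V.IsHermitian

namespace ConfinedMultisystem

variable {ℓ : ℕ} {n : Type} [Fintype n] [DecidableEq n] (S : ConfinedMultisystem ℓ n)

/-- The full Hamiltonian `H = H_0 + V`, with `H_0 = ∑ j, H_j`. -/
def H : Matrix n n ℂ := ∑ j, S.E j + S.V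

/-- The unitary group `exp (i t H)`. -/
def U (t : ℝ) : Matrix n n ℂ := NormedSpace.exp ((Complex.I * (t : ℂ)) • S.H)

/-- The finite set of possible outcomes `e = (e_1, …, e_ℓ)`, `e_j ∈ sp H_j`, of a measurement
of all the `H_j`. -/
def outcomes : Finset (Fin ℓ → ℝ) :=
  Fintype.piFinset fun j => (Matrix.finite_real_spectrum (A := S.E j)).toFinset

/-- The joint spectral projection `P_e`: the orthogonal projection onto the vectors `ψ` with
`H_j ψ = e_j ψ` for every `j`. -/
def proj (e : Fin ℓ → ℝ) : Matrix n n ℂ :=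
  (Matrix.toEuclideanCLM (n := n) (𝕜 := ℂ)).symm
    (⨅ j, Module.End.eigenspace
      (Matrix.toEuclideanCLM (n := n) (𝕜 := ℂ) (S.E j)).toLinearMap (e j : ℂ)).starProjection

/-- The a priori state `∑ e, P_e ρ P_e`. -/
def aprioriState : Matrix n n ℂ := ∑ e ∈ S.outcomes, S.proj e * S.ρ * S.proj e

/-- The probability that measurements of all the `H_j` at time `0` and at time `t` give `e` and
then `e'`. -/
def jointProb (t : ℝ) (e e' : Fin ℓ → ℝ) : ℝ :=
  (S.U (-t) * (S.aprioriState * S.proj e) * S.U t * S.proj e').trace.re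

/-- The law `ℙ_t` on `ℝ^ℓ` of the vector of heat variation rates `φ = (e' - e) / t`
(at `t = 0`, where `e' = e` almost surely, it is the point mass at `0`). -/
def law (t : ℝ) : MeasureTheory.Measure (Fin ℓ → ℝ) :=
  ∑ e ∈ S.outcomes, ∑ e' ∈ S.outcomes,
    ENNReal.ofReal (S.jointProb t e e') • MeasureTheory.Measure.dirac (t⁻¹ • (e' - e))

/-- The generating function `χ_t(α) = 𝔼_t (exp (- t α.φ))`, for `α ∈ ℂ^ℓ`. -/
def χ (t : ℝ) (α : Fin ℓ → ℂ) : ℂ :=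
  ∫ φ, Complex.exp (-(t : ℂ) * ∑ j, α j * (φ j : ℂ)) ∂(S.law t)

/-- The deformed interaction `V_α = exp (α.E / 2) V exp (- α.E / 2)`, for `α ∈ ℝ^ℓ`. -/
def deformedV (α : Fin ℓ → ℝ) : Matrix n n ℂ :=
  NormedSpace.exp (((1 : ℂ) / 2) • ∑ j, (α j : ℂ) • S.E j) * S.V *
    NormedSpace.exp (-(((1 : ℂ) / 2) • ∑ j, (α j : ℂ) • S.E j))

/-- `S(α₀, θ₀)`: the supremum of `‖V_{α + θ 1}‖` over `|θ| ≤ θ₀` and over the `α ∈ ℝ^ℓ` with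
`∑ j, α_j = 0` and `max_j |α_j| < α₀`. -/
def regularityBound (α₀ θ₀ : ℝ) : ℝ≥0∞ :=
  ⨆ (θ : ℝ) (_ : |θ| ≤ θ₀) (α : Fin ℓ → ℝ) (_ : ∑ j, α j = 0 ∧ ‖α‖ < α₀),
    ENNReal.ofReal ‖S.deformedV (α + fun _ => θ)‖

end ConfinedMultisystem

/-! ### Assumptions on multi-reservoir systems -/

section Assumptions

variable {ℓ : ℕ} {n : ℕ → Type} [∀ L, Fintype (n L)] [∀ L, DecidableEq (n L)]

/-- Assumption TL for a family of confined multisystems: for `t ≥ 0` and `α ∈ i ℝ^ℓ` the limit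
of `χ_t^{(L)}(α)` as `L → ∞` exists and is finite, and it is continuous in `α ∈ i ℝ^ℓ` at `0`. -/
def AssumptionTL (S : ∀ L, ConfinedMultisystem ℓ (n L)) : Prop :=
  ∃ χlim : ℝ → (Fin ℓ → ℝ) → ℂ,
    (∀ t : ℝ, 0 ≤ t → ∀ a : Fin ℓ → ℝ,
      Filter.Tendsto (fun L => (S L).χ t fun j => Complex.I * (a j : ℂ)) Filter.atTop
        (𝓝 (χlim t a))) ∧
    ∀ t : ℝ, 0 ≤ t → ContinuousAt (χlim t) 0

/-- Assumption B(α₀, θ₀): `α₀ > 0`, `θ₀ ≥ α₀`, and `sup_L S^{(L)}(α₀, θ₀)` is finite. -/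
def AssumptionB (S : ∀ L, ConfinedMultisystem ℓ (n L)) (α₀ θ₀ : ℝ) : Prop :=
  0 < α₀ ∧ α₀ ≤ θ₀ ∧ (⨆ L, (S L).regularityBound α₀ θ₀) < ⊤

end Assumptions

/-! ### Operators on spin systems

The Hilbert space `⨂_{y ∈ Y} ℂ^k` has the product basis indexed by the configurations
`Y → Fin k`. -/

/-- The copy, on the sites `Y`, of an operator `A` on `⨂_{i ∈ I} ℂ^k`, along an injection
`e : I → Y`: it acts as `A` on the sites `e i` and as the identity on all the others. -/
def place {k : ℕ} {I Y : Type} (e : I → Y) (A : Matrix (I → Fin k) (I → Fin k) ℂ) :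
    Matrix (Y → Fin k) (Y → Fin k) ℂ :=
  open Classical in
  Matrix.of fun σ τ => if ∀ y, y ∉ Set.range e → σ y = τ y then A (σ ∘ e) (τ ∘ e) else 0

theorem place_isHermitian {k : ℕ} {I Y : Type} (e : I → Y)
    {A : Matrix (I → Fin k) (I → Fin k) ℂ} (hA : A.IsHermitian) : (place e A).IsHermitian := by
  ext σ τ
  have h : (∀ y, y ∉ Set.range e → τ y = σ y) ↔ (∀ y, y ∉ Set.range e → σ y = τ y) :=
    forall_congr' fun y => imp_congr_right fun _ => eq_comm
  simp only [place, Matrix.conjTranspose_apply, Matrix.of_apply]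
  by_cases h' : ∀ y, y ∉ Set.range e → σ y = τ y
  · rw [if_pos h', if_pos (h.2 h')]
    exact hA.apply _ _
  · rw [if_neg h', if_neg fun h'' => h' (h.1 h''), star_zero]

theorem place_mul_place {k : ℕ} {I I' Y : Type} [Fintype Y] [DecidableEq Y] (e : I → Y)
    (e' : I' → Y) (hd : Disjoint (Set.range e) (Set.range e'))
    (A : Matrix (I → Fin k) (I → Fin k) ℂ) (B : Matrix (I' → Fin k) (I' → Fin k) ℂ)
    (σ τ : Y → Fin k) [Decidable (∀ y, y ∉ Set.range e → y ∉ Set.range e' → σ y = τ y)] :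
    (place e A * place e' B) σ τ =
      if ∀ y, y ∉ Set.range e → y ∉ Set.range e' → σ y = τ y then
        A (σ ∘ e) (τ ∘ e) * B (σ ∘ e') (τ ∘ e') else 0 := by
  classical
  rw [Matrix.mul_apply, Finset.sum_eq_single fun y => if y ∈ Set.range e then τ y else σ y]
  · have h1 : ((fun y => if y ∈ Set.range e then τ y else σ y) ∘ e) = τ ∘ e := by
      funext i; simp
    have h2 : ((fun y => if y ∈ Set.range e then τ y else σ y) ∘ e') = σ ∘ e' := by
      funext i
      have : e' i ∉ Set.range e := fun h => hd.le_bot ⟨h, Set.mem_range_self i⟩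
      simp only [Function.comp_apply, if_neg this]
    simp only [place, Matrix.of_apply, h1, h2]
    rw [if_pos (by intro y hy; simp only [if_neg hy])]
    by_cases h : ∀ y, y ∉ Set.range e → y ∉ Set.range e' → σ y = τ y
    · rw [if_pos h, if_pos]
      intro y hy
      by_cases hy' : y ∈ Set.range e
      · simp only [if_pos hy']
      · simpa only [if_neg hy'] using h y hy' hy
    · rw [if_neg h, if_neg, mul_zero]
      intro h'
      refine h fun y hy hy' => ?_
      simpa only [if_neg hy] using h' y hy'
  · intro κ _ hκ
    simp only [place, Matrix.of_apply]
    by_cases h1 : ∀ y, y ∉ Set.range e → σ y = κ y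
    · by_cases h2 : ∀ y, y ∉ Set.range e' → κ y = τ y
      · refine absurd (funext fun y => ?_) hκ
        by_cases hy : y ∈ Set.range e
        · simp only [if_pos hy]
          exact h2 y fun hy' => hd.le_bot ⟨hy, hy'⟩
        · simp only [if_neg hy]
          exact (h1 y hy).symm
      · rw [if_neg h2, mul_zero]
    · rw [if_neg h1, zero_mul]
  · intro h
    exact absurd (Finset.mem_univ _) h

theorem place_commute {k : ℕ} {I I' Y : Type} [Fintype Y] [DecidableEq Y] (e : I → Y)
    (e' : I' → Y) (hd : Disjoint (Set.range e) (Set.range e'))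
    (A : Matrix (I → Fin k) (I → Fin k) ℂ) (B : Matrix (I' → Fin k) (I' → Fin k) ℂ) :
    Commute (place e A) (place e' B) := by
  classical
  ext σ τ
  have h : (∀ y, y ∉ Set.range e' → y ∉ Set.range e → σ y = τ y) ↔
      (∀ y, y ∉ Set.range e → y ∉ Set.range e' → σ y = τ y) :=
    forall_congr' fun y => ⟨fun h a b => h b a, fun h a b => h b a⟩
  rw [place_mul_place e e' hd, place_mul_place e' e hd.symm]
  simp only [h, mul_comm]

/-- The multi-thermal state `exp (- β.E) / tr (exp (- β.E))`. -/
def gibbs {ℓ : ℕ} {n : Type} [Fintype n] [DecidableEq n] (β : Fin ℓ → ℝ)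
    (E : Fin ℓ → Matrix n n ℂ) : Matrix n n ℂ :=
  (NormedSpace.exp (-∑ j, (β j : ℂ) • E j)).trace⁻¹ • NormedSpace.exp (-∑ j, (β j : ℂ) • E j)

theorem gibbs_aux {ℓ : ℕ} {n : Type} [Fintype n] [DecidableEq n] [Nonempty n] (β : Fin ℓ → ℝ)
    (E : Fin ℓ → Matrix n n ℂ) (hE : ∀ j, (E j).IsHermitian) :
    (NormedSpace.exp (-∑ j, (β j : ℂ) • E j)).PosDef := by
  set A : Matrix n n ℂ := -∑ j, (β j : ℂ) • E j with hA
  have hAh : A.IsHermitian := by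
    refine IsSelfAdjoint.neg (isSelfAdjoint_sum _ fun j _ => ?_)
    exact IsSelfAdjoint.smul (by simp [isSelfAdjoint_iff]) (hE j)
  have hBh : (((1 : ℂ) / 2) • A).IsHermitian :=
    IsSelfAdjoint.smul (by simp [isSelfAdjoint_iff]) hAh
  have hexp : NormedSpace.exp A =
      (NormedSpace.exp (((1 : ℂ) / 2) • A)).conjTranspose *
        NormedSpace.exp (((1 : ℂ) / 2) • A) := by
    rw [hBh.exp.eq, ← Matrix.exp_add_of_commute _ _ (Commute.refl _), ← add_smul]
    norm_num
  rw [hexp]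
  exact Matrix.PosDef.conjTranspose_mul_self _
    (Matrix.mulVec_injective_iff_isUnit.2 (Matrix.isUnit_exp _))

theorem gibbs_posSemidef {ℓ : ℕ} {n : Type} [Fintype n] [DecidableEq n] [Nonempty n]
    (β : Fin ℓ → ℝ) (E : Fin ℓ → Matrix n n ℂ) (hE : ∀ j, (E j).IsHermitian) :
    (gibbs β E).PosSemidef := by
  have h := gibbs_aux β E hE
  exact h.posSemidef.smul (inv_nonneg.2 h.trace_pos.le)

theorem gibbs_trace {ℓ : ℕ} {n : Type} [Fintype n] [DecidableEq n] [Nonempty n]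
    (β : Fin ℓ → ℝ) (E : Fin ℓ → Matrix n n ℂ) (hE : ∀ j, (E j).IsHermitian) :
    (gibbs β E).trace = 1 := by
  have h := (gibbs_aux β E hE).trace_pos.ne'
  rw [gibbs, Matrix.trace_smul, smul_eq_mul, inv_mul_cancel₀ h]

/-! ### The lattice and the open quantum spin system -/

/-- The vertices of `ℤ^d`. -/
abbrev Site (d : ℕ) : Type := Fin d → ℤ

/-- The `2 d + 1` positions in the star of a vertex: the vertex itself and its neighbours. -/
abbrev StarIdx (d : ℕ) : Type := Option (Fin d × Bool)

/-- The star of `x`: `none ↦ x`, `(i, true) ↦ x + e_i`, `(i, false) ↦ x - e_i`. -/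
def vertexStar {d : ℕ} (x : Site d) : StarIdx d → Site d
  | none => x
  | some (i, true) => x + Pi.single i 1
  | some (i, false) => x - Pi.single i 1

/-- The box `{-L, …, L}^d`. -/
def box (d L : ℕ) : Finset (Site d) := Finset.Icc (fun _ => -(L : ℤ)) (fun _ => (L : ℤ))

/-- The sites of the `L`-th confined system: the box together with the neighbours of its
vertices, on which the local terms centred in the box act. -/
def sites (d L : ℕ) : Finset (Site d) :=
  (box d L).biUnion fun x => Finset.univ.image (vertexStar x)

theorem star_mem_sites {d L : ℕ} {x : Site d} (hx : x ∈ box d L) (u : StarIdx d) :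
    vertexStar x u ∈ sites d L :=
  Finset.mem_biUnion.2 ⟨x, hx, Finset.mem_image_of_mem _ (Finset.mem_univ u)⟩

theorem sites_mono {d L M : ℕ} (h : L ≤ M) : sites d L ⊆ sites d M := by
  refine Finset.biUnion_subset_biUnion_of_subset_left _ (Finset.Icc_subset_Icc ?_ ?_)
  · intro _
    exact neg_le_neg (Int.ofNat_le.2 h)
  · intro _
    exact Int.ofNat_le.2 h

/-- The spin configurations of the `L`-th confined system, a basis of `⨂_{y ∈ sites} ℂ^k`. -/
abbrev Config (d k L : ℕ) : Type := sites d L → Fin k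

/-- `S_x`: the copy of `S` that acts on `x` and its neighbours, for `x` in the box. -/
def localTerm {d k : ℕ} (S : Matrix (StarIdx d → Fin k) (StarIdx d → Fin k) ℂ) (L : ℕ)
    (x : box d L) : Matrix (Config d k L) (Config d k L) ℂ :=
  place (fun u => ⟨vertexStar x.1 u, star_mem_sites x.2 u⟩) S

/-- A partition of `ℤ^d` into `ℓ` labelled parts is given by a map `p`, with parts
`p ⁻¹' {j}`. The union of the boundaries of the parts is the set of the vertices that have a
neighbour in another part; the boundary of the part `j` consists of those that lie in it. -/
def boundary {d ℓ : ℕ} (p : Site d → Fin ℓ) : Set (Site d) := {x | ∃ u, p (vertexStar x u) ≠ p x}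

/-- The energy of the `j`-th reservoir: `∑ S_x` over the vertices `x` of the part `j` in the
box that are not in the boundary of this part. -/
def reservoirH {d k ℓ : ℕ} (p : Site d → Fin ℓ)
    (S : Matrix (StarIdx d → Fin k) (StarIdx d → Fin k) ℂ) (L : ℕ) (j : Fin ℓ) :
    Matrix (Config d k L) (Config d k L) ℂ :=
  open Classical in
  ∑ x : box d L, if p x.1 = j ∧ x.1 ∉ boundary p then localTerm S L x else 0

/-- The interaction: `∑ J(x) S_x` over the boundary vertices `x` in the box. -/
def interaction {d k ℓ : ℕ} (p : Site d → Fin ℓ)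
    (S : Matrix (StarIdx d → Fin k) (StarIdx d → Fin k) ℂ) (J : Site d → ℝ) (L : ℕ) :
    Matrix (Config d k L) (Config d k L) ℂ :=
  open Classical in
  ∑ x : box d L, if x.1 ∈ boundary p then (J x.1 : ℂ) • localTerm S L x else 0

theorem reservoirH_isHermitian {d k ℓ : ℕ} (p : Site d → Fin ℓ)
    {S : Matrix (StarIdx d → Fin k) (StarIdx d → Fin k) ℂ} (hS : S.IsHermitian) (L : ℕ)
    (j : Fin ℓ) : (reservoirH p S L j).IsHermitian := by
  refine isSelfAdjoint_sum _ fun x _ => ?_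
  split_ifs
  · exact place_isHermitian _ hS
  · exact IsSelfAdjoint.zero _

theorem interaction_isHermitian {d k ℓ : ℕ} (p : Site d → Fin ℓ)
    {S : Matrix (StarIdx d → Fin k) (StarIdx d → Fin k) ℂ} (hS : S.IsHermitian)
    (J : Site d → ℝ) (L : ℕ) : (interaction p S J L).IsHermitian := by
  refine isSelfAdjoint_sum _ fun x _ => ?_
  split_ifs
  · exact IsSelfAdjoint.smul (by simp [isSelfAdjoint_iff]) (place_isHermitian _ hS)
  · exact IsSelfAdjoint.zero _

theorem reservoirH_commute {d k ℓ : ℕ} (p : Site d → Fin ℓ)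
    (S : Matrix (StarIdx d → Fin k) (StarIdx d → Fin k) ℂ) (L : ℕ) (i j : Fin ℓ) :
    Commute (reservoirH p S L i) (reservoirH p S L j) := by
  by_cases hij : i = j
  · rw [hij]
  refine Commute.sum_left _ _ _ fun x _ => Commute.sum_right _ _ _ fun y _ => ?_
  split_ifs with hx hy
  · refine place_commute _ _ (Set.disjoint_left.2 ?_) _ _
    rintro _ ⟨u, rfl⟩ ⟨v, hv⟩
    have hxu : p (vertexStar x.1 u) = p x.1 := by
      by_contra h
      exact hx.2 ⟨u, h⟩
    have hyv : p (vertexStar y.1 v) = p y.1 := by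
      by_contra h
      exact hy.2 ⟨v, h⟩
    have : vertexStar y.1 v = vertexStar x.1 u := congrArg Subtype.val hv
    exact hij (by rw [← hx.1, ← hy.1, ← hxu, ← hyv, this])
  · exact Commute.zero_right _
  · exact Commute.zero_left _
  · exact Commute.zero_left _

/-- The `L`-th confined multisystem of the open quantum spin system, in the multi-thermal state
at inverse temperatures `β`. -/
def spinSystem {d k ℓ : ℕ} [NeZero k] (p : Site d → Fin ℓ)
    (S : Matrix (StarIdx d → Fin k) (StarIdx d → Fin k) ℂ) (hS : S.IsHermitian)
    (J : Site d → ℝ) (β : Fin ℓ → ℝ) (L : ℕ) : ConfinedMultisystem ℓ (Config d k L) where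
  ρ := gibbs β (reservoirH p S L)
  E := reservoirH p S L
  V := interaction p S J L
  ρ_posSemidef := gibbs_posSemidef β _ (reservoirH_isHermitian p hS L)
  ρ_trace := gibbs_trace β _ (reservoirH_isHermitian p hS L)
  E_hermitian := reservoirH_isHermitian p hS L
  E_commute := reservoirH_commute p S L
  V_hermitian := interaction_isHermitian p hS J L

/-! ### The quasi-local algebra -/

/-- The embedding `A ↦ A ⊗ 1` of the operators of the `L`-th volume into those of the `M`-th. -/
def extend {d k L M : ℕ} (h : L ≤ M) (A : Matrix (Config d k L) (Config d k L) ℂ) :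
    Matrix (Config d k M) (Config d k M) ℂ :=
  place (fun y => ⟨y.1, sites_mono h y.2⟩) A

/-- An element of the quasi-local algebra over `ℤ^d`, the norm completion of the union of the
matrix algebras of the finite volumes under the embeddings `A ↦ A ⊗ 1`. As always for a
completion, it is given by a Cauchy sequence, here with its `L`-th term in the `L`-th volume;
two sequences whose difference tends to `0` in norm give the same element. -/
structure QuasiLocal (d k : ℕ) where
  approx : ∀ L, Matrix (Config d k L) (Config d k L) ℂ
  cauchy : ∀ ε : ℝ, 0 < ε → ∃ N, ∀ L M, N ≤ L → ∀ h : L ≤ M,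
    ‖approx M - extend h (approx L)‖ < ε

/-- The states `ρ^{(L)}` converge on the quasi-local algebra: `lim_L tr (ρ^{(L)} A)` exists for
every quasi-local `A`. Changing `A` in the `L`-th volume by an error that tends to `0` in norm
does not affect the limit, as `ρ^{(L)}` has trace norm `1`; for `A` in a finite volume, the
approximating sequence is eventually `A ⊗ 1`. -/
def StatesConverge {d k ℓ : ℕ} (S : ∀ L, ConfinedMultisystem ℓ (Config d k L)) : Prop :=
  ∀ A : QuasiLocal d k, ∃ z : ℂ,
    Filter.Tendsto (fun L => ((S L).ρ * A.approx L).trace) Filter.atTop (𝓝 z)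

end

end OpenSpin

/-! Everything rests on one volume-independent estimate, `norm_delta_pow_le`. If `K = ∑ c_y S_y` and
each `S_x` fails to commute with only boundedly many `S_y`, then the `n`-fold commutator of `K` with
`S_x` has norm at most `‖S‖ n! R^n`, where `R` is proportional to a bound on the `|c_y|`. The
factorial is absorbed by the exponential series, so `e^K S_x e^{-K}` is bounded uniformly in `L`
once `R < 1`, even if `e^K` is not unitary. Weighted by the summable `J`, this bounds `V_α` for
small `α`, which is assumption B.

For TL, the Gibbs state commutes with the joint spectral projections, so `χ_t(α)` is the trace of `ρ
e^{α·E} e^{itH} e^{-α·E} e^{-itH}` (`χ_eq_trace`). For imaginary `α` and `K = α·E` it is also the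
trace of `ρ e^K G e^{-K} G^*`, with the cocycle `G = e^{itH} e^{-itH₀}` (`χ_eq_trace_cocycle`). By
the convergence of the states it remains to see that `e^K G e^{-K} G^*` defines a quasi-local
element. The class `LocallyGenerated` serves this purpose: it contains the local terms, is closed
under algebraic operations and under limits uniform in `L`, and its members are Cauchy
(`LocallyGenerated.cauchy`).

Closure under unitary conjugation (`exp_conj`) and membership of the cocycle (`exp_mul_exp`) come
from the series when the coefficients are small, and in general from composing `n` steps with
coefficients divided by `n`. For the cocycle the series is that of `X ↦ AX - XB` started at `1`; its
first term is the perturbation alone, which is summable in norm although `H₀` is not. Continuity of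
the limit at `0` holds because `exp_conj_continuous` is uniform in `L`. -/

namespace OpenSpin

noncomputable section

/-! ### Generalised commutators and their exponentials -/

section GeneralizedCommutator

open Finset

variable {𝔸 : Type*} [NormedRing 𝔸] [NormedAlgebra ℂ 𝔸]

/-- The generalised commutator `X ↦ A X - X B`. -/
def delta (A B : 𝔸) : 𝔸 →L[ℂ] 𝔸 :=
  ContinuousLinearMap.mul ℂ 𝔸 A - (ContinuousLinearMap.mul ℂ 𝔸).flip B

theorem delta_apply (A B X : 𝔸) : delta A B X = A * X - X * B := rfl

/-- The Leibniz rule for powers of generalised commutators. -/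
theorem delta_pow_mul (A B C X Y : 𝔸) (n : ℕ) :
    (delta A C ^ n) (X * Y) =
      ∑ ij ∈ antidiagonal n, n.choose ij.1 • ((delta A B ^ ij.1) X * (delta B C ^ ij.2) Y) := by
  induction n with
  | zero => simp
  | succ n ih =>
    rw [sum_antidiagonal_choose_succ_nsmul
      (fun i j => (delta A B ^ i) X * (delta B C ^ j) Y) n, pow_succ', mul_apply_eq_comp,
      ih, map_sum, ← sum_add_distrib]
    refine sum_congr rfl fun ij hij => ?_
    rw [map_nsmul, Nat.choose_symm_of_eq_add (mem_antidiagonal.1 hij).symm, ← nsmul_add]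
    congr 1
    simp only [pow_succ', mul_apply_eq_comp, delta_apply]
    noncomm_ring

/-- In the Leibniz rule the binomial coefficient turns `i! j!` into `n!`, so all `n + 1` terms obey
the same bound and their sum produces `(n + 1)!`. This is exactly the growth allowed for one further
commutator. -/
theorem norm_delta_pow_mul_le {A B C X Y : 𝔸} {n : ℕ} {a b R : ℝ} (hR : 0 ≤ R) (ha : 0 ≤ a)
    (hX : ∀ i ≤ n, ‖(delta A B ^ i) X‖ ≤ a * (i.factorial * R ^ i))
    (hY : ∀ i ≤ n, ‖(delta B C ^ i) Y‖ ≤ b * (i.factorial * R ^ i)) :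
    ‖(delta A C ^ n) (X * Y)‖ ≤ a * b * ((n + 1).factorial * R ^ n) := by
  rw [delta_pow_mul A B C]
  calc _ ≤ ∑ ij ∈ antidiagonal n, a * b * (n.factorial * R ^ n) := by
        refine (norm_sum_le _ _).trans (sum_le_sum fun ij hij => ?_)
        have hij' := mem_antidiagonal.1 hij
        rw [← Nat.cast_smul_eq_nsmul ℂ, norm_smul, Complex.norm_natCast]
        have h1 := hX ij.1 (by omega)
        have h2 := hY ij.2 (by omega)
        have h3 : (n.choose ij.1 : ℝ) * (ij.1.factorial * ij.2.factorial) = n.factorial := by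
          rw [← hij', ← mul_assoc]
          have := Nat.choose_mul_factorial_mul_factorial (Nat.le_add_right ij.1 ij.2)
          rw [Nat.add_sub_cancel_left] at this
          exact_mod_cast this
        calc _ ≤ (n.choose ij.1 : ℝ) * ((a * (ij.1.factorial * R ^ ij.1)) *
              (b * (ij.2.factorial * R ^ ij.2))) := by
              gcongr
              exact (norm_mul_le _ _).trans (mul_le_mul h1 h2 (norm_nonneg _) (by positivity))
          _ = a * b * ((n.choose ij.1 : ℝ) * (ij.1.factorial * ij.2.factorial) *
                R ^ (ij.1 + ij.2)) := by ring
          _ = _ := by rw [h3, hij']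
    _ = _ := by
        rw [sum_const, Nat.card_antidiagonal, nsmul_eq_mul, Nat.factorial_succ]
        push_cast
        ring

/-- In a local interaction `K = ∑ c_y s_y`, the iterated commutators of `K` with a local term
grow at most like `n! R ^ n`. -/
theorem norm_delta_pow_le {ι : Type*} {s : ι → 𝔸} {N : ι → Finset ι} {c : ι → ℂ} {K : 𝔸}
    (hK : ∀ x, delta K K (s x) = ∑ y ∈ N x, c y • (s y * s x - s x * s y))
    {D : ℕ} {C M : ℝ} (hD : ∀ x, #(N x) ≤ D) (hC : ∀ x, ‖c x‖ ≤ C) (hM : ∀ x, ‖s x‖ ≤ M)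
    (hC0 : 0 ≤ C) (hM0 : 0 ≤ M) (n : ℕ) :
    ∀ x, ‖(delta K K ^ n) (s x)‖ ≤ M * (n.factorial * (2 * D * C * M) ^ n) := by
  induction n using Nat.strong_induction_on with
  | _ n ih =>
    intro x
    cases n with
    | zero => simpa using hM x
    | succ n =>
      have hR : 0 ≤ 2 * D * C * M := by positivity
      have key : ∀ y z, ‖(delta K K ^ n) (s y * s z)‖ ≤
          M * M * ((n + 1).factorial * (2 * D * C * M) ^ n) := fun y z =>
        norm_delta_pow_mul_le hR hM0 (fun i hi => ih i (by omega) y) (fun i hi => ih i (by omega) z)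
      -- The innermost commutator is taken first: it leaves at most `D` commutators of two local
      -- terms, and the other `n` are distributed over each product by the Leibniz rule. The new
      -- factor `2 D C M` counts the neighbours, the two orders of the product, the coefficient and
      -- the additional local term.
      rw [pow_succ, mul_apply_eq_comp, hK, map_sum]
      calc _ ≤ ∑ y ∈ N x, C * (2 * (M * M * ((n + 1).factorial * (2 * D * C * M) ^ n))) := by
            refine (norm_sum_le _ _).trans (sum_le_sum fun y _ => ?_)
            rw [map_smul, norm_smul, map_sub, two_mul]
            exact mul_le_mul (hC y) ((norm_sub_le _ _).trans (add_le_add (key _ _) (key _ _)))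
              (norm_nonneg _) hC0
        _ ≤ D * (C * (2 * (M * M * ((n + 1).factorial * (2 * D * C * M) ^ n)))) := by
            rw [sum_const, nsmul_eq_mul]
            gcongr
            exact_mod_cast hD x
        _ = _ := by ring

theorem mul_pow_apply (A X : 𝔸) (n : ℕ) : (ContinuousLinearMap.mul ℂ 𝔸 A ^ n) X = A ^ n * X := by
  induction n with
  | zero => simp
  | succ n ih => rw [pow_succ', mul_apply_eq_comp, ih, ContinuousLinearMap.mul_apply',
      pow_succ', mul_assoc]

theorem mul_flip_pow_apply (B X : 𝔸) (n : ℕ) :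
    ((-(ContinuousLinearMap.mul ℂ 𝔸).flip B) ^ n) X = X * (-B) ^ n := by
  induction n with
  | zero => simp
  | succ n ih =>
    rw [pow_succ', mul_apply_eq_comp, ih, pow_succ, ← mul_assoc]
    simp

variable [CompleteSpace 𝔸]

theorem hasSum_exp_apply (T : 𝔸 →L[ℂ] 𝔸) (X : 𝔸) :
    HasSum (fun n : ℕ => (n.factorial : ℂ)⁻¹ • (T ^ n) X) (NormedSpace.exp T X) := by
  have h := NormedSpace.exp_series_hasSum_exp' (𝕂 := ℂ) T
  have h' := h.mapL (ContinuousLinearMap.apply ℂ 𝔸 X)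
  simpa only [ContinuousLinearMap.apply_apply, smul_apply] using h'

/-- Left multiplication by `A` and right multiplication by `-B` commute, so the exponential of their
sum `delta A B` is the composition of their exponentials. Allowing `A ≠ B` covers cocycles (`X = 1`)
as well as conjugations. -/
theorem hasSum_exp_mul_mul_exp (A B X : 𝔸) :
    HasSum (fun n : ℕ => (n.factorial : ℂ)⁻¹ • (delta A B ^ n) X)
      (NormedSpace.exp A * X * NormedSpace.exp (-B)) := by
  have hl : ∀ X, NormedSpace.exp (ContinuousLinearMap.mul ℂ 𝔸 A) X = NormedSpace.exp A * X := by
    intro X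
    refine (hasSum_exp_apply _ X).unique ?_
    simp only [mul_pow_apply, ← smul_mul_assoc]
    exact (NormedSpace.exp_series_hasSum_exp' (𝕂 := ℂ) A).mul_right X
  have hr : ∀ X, NormedSpace.exp (-(ContinuousLinearMap.mul ℂ 𝔸).flip B) X =
      X * NormedSpace.exp (-B) := by
    intro X
    refine (hasSum_exp_apply _ X).unique ?_
    simp only [mul_flip_pow_apply, ← mul_smul_comm]
    exact (NormedSpace.exp_series_hasSum_exp' (𝕂 := ℂ) (-B)).mul_left X
  have hc : Commute (ContinuousLinearMap.mul ℂ 𝔸 A) (-(ContinuousLinearMap.mul ℂ 𝔸).flip B) := by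
    ext X
    simp [mul_assoc]
  have h : NormedSpace.exp (delta A B) X = NormedSpace.exp A * X * NormedSpace.exp (-B) := by
    let _ : NormedAlgebra ℚ (𝔸 →L[ℂ] 𝔸) := NormedAlgebra.restrictScalars ℚ ℂ _
    rw [delta, sub_eq_add_neg, NormedSpace.exp_add_of_commute hc, mul_apply_eq_comp,
      hr, hl, mul_assoc]
  rw [← h]
  exact hasSum_exp_apply _ X

/-- This splits off one step of an evolution, so that results for small exponents can be iterated.
-/
theorem exp_add_mul_mul_exp {A B A' B' X : 𝔸} (hA : Commute A A') (hB : Commute B B') :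
    NormedSpace.exp (A + A') * X * NormedSpace.exp (-(B + B')) =
      NormedSpace.exp A * (NormedSpace.exp A' * X * NormedSpace.exp (-B')) *
        NormedSpace.exp (-B) := by
  let _ : NormedAlgebra ℚ 𝔸 := NormedAlgebra.restrictScalars ℚ ℂ _
  rw [NormedSpace.exp_add_of_commute hA, add_comm, neg_add,
    NormedSpace.exp_add_of_commute (hB.symm.neg_left.neg_right)]
  simp only [mul_assoc]

theorem exp_neg_mul_exp (A : 𝔸) : NormedSpace.exp (-A) * NormedSpace.exp A = 1 := by
  let _ : NormedAlgebra ℚ 𝔸 := NormedAlgebra.restrictScalars ℚ ℂ _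
  rw [← NormedSpace.exp_add_of_commute (Commute.refl A).neg_left, neg_add_cancel,
    NormedSpace.exp_zero]

theorem exp_mul_exp_neg (A : 𝔸) : NormedSpace.exp A * NormedSpace.exp (-A) = 1 := by
  simpa using exp_neg_mul_exp (-A)

theorem norm_inv_factorial_smul_le {E : Type*} [NormedAddCommGroup E] [NormedSpace ℂ E] {X : E}
    {n : ℕ} {a r : ℝ} (h : ‖X‖ ≤ a * (n.factorial * r)) :
    ‖(n.factorial : ℂ)⁻¹ • X‖ ≤ a * r := by
  rw [norm_smul, norm_inv, Complex.norm_natCast, inv_mul_le_iff₀ (by positivity)]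
  linarith

/-- The `n!` in the hypothesis cancels against the exponential series and leaves a geometric series.
-/
theorem norm_exp_mul_mul_exp_le {A B X : 𝔸} {a r : ℝ}
    (h : ∀ n, ‖(delta A B ^ n) X‖ ≤ a * (n.factorial * r ^ n)) (hr : 0 ≤ r) (hr1 : r < 1) :
    ‖NormedSpace.exp A * X * NormedSpace.exp (-B)‖ ≤ a * (1 - r)⁻¹ :=
  (hasSum_exp_mul_mul_exp A B X).norm_le_of_bounded
    ((hasSum_geometric_of_lt_one hr hr1).mul_left a) fun n => norm_inv_factorial_smul_le (h n)

theorem norm_exp_mul_mul_exp_sub_le {A B X : 𝔸} {a r : ℝ}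
    (h : ∀ n, ‖(delta A B ^ n) X‖ ≤ a * (n.factorial * r ^ n)) (hr : 0 ≤ r) (hr1 : r < 1) :
    ‖NormedSpace.exp A * X * NormedSpace.exp (-B) - X‖ ≤ a * ((1 - r)⁻¹ - 1) := by
  have h1 := (hasSum_nat_add_iff' 1).2 (hasSum_exp_mul_mul_exp A B X)
  have h2 := (hasSum_nat_add_iff' 1).2 (hasSum_geometric_of_lt_one hr hr1)
  simp only [Finset.sum_range_one, Nat.factorial_zero, Nat.cast_one, inv_one, pow_zero, one_smul,
    one_apply_eq_self] at h1 h2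
  exact h1.norm_le_of_bounded (h2.mul_left a) fun n => norm_inv_factorial_smul_le (h (n + 1))

end GeneralizedCommutator

/-! ### Placing operators is an injective homomorphism -/

section Place

variable {k : ℕ} {I Y Z : Type}

theorem place_add (e : I → Y) (A B : Matrix (I → Fin k) (I → Fin k) ℂ) :
    place e (A + B) = place e A + place e B := by
  ext σ τ
  simp only [place, Matrix.of_apply, Matrix.add_apply]
  split_ifs <;> simp

theorem place_zero (e : I → Y) : place e (0 : Matrix (I → Fin k) (I → Fin k) ℂ) = 0 := by
  ext σ τ
  simp [place]

theorem place_smul (e : I → Y) (c : ℂ) (A : Matrix (I → Fin k) (I → Fin k) ℂ) :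
    place e (c • A) = c • place e A := by
  ext σ τ
  simp only [place, Matrix.of_apply, Matrix.smul_apply]
  split_ifs <;> simp

theorem place_star (e : I → Y) (A : Matrix (I → Fin k) (I → Fin k) ℂ) :
    place e (star A) = star (place e A) := by
  ext σ τ
  have h : (∀ y, y ∉ Set.range e → τ y = σ y) ↔ (∀ y, y ∉ Set.range e → σ y = τ y) :=
    forall_congr' fun y => imp_congr_right fun _ => eq_comm
  simp only [place, Matrix.of_apply, Matrix.star_apply]
  by_cases h' : ∀ y, y ∉ Set.range e → σ y = τ y
  · rw [if_pos h', if_pos (h.2 h')]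
  · rw [if_neg h', if_neg fun h'' => h' (h.1 h''), star_zero]

theorem place_one [DecidableEq I] [DecidableEq Y] [Fintype I] [Fintype Y] (e : I → Y) :
    place e (1 : Matrix (I → Fin k) (I → Fin k) ℂ) = 1 := by
  ext σ τ
  simp only [place, Matrix.of_apply, Matrix.one_apply]
  by_cases h : σ = τ
  · simp [h]
  · rw [if_neg h]
    split_ifs with h1 h2
    · refine absurd (funext fun y => ?_) h
      by_cases hy : y ∈ Set.range e
      · obtain ⟨i, rfl⟩ := hy
        exact congrFun h2 i
      · exact h1 y hy
    · rfl
    · rfl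

theorem place_mul [Fintype I] [DecidableEq I] [Fintype Y] [DecidableEq Y] {e : I → Y}
    (he : e.Injective) (A B : Matrix (I → Fin k) (I → Fin k) ℂ) :
    place e (A * B) = place e A * place e B := by
  classical
  ext σ τ
  rw [Matrix.mul_apply]
  by_cases h : ∀ y, y ∉ Set.range e → σ y = τ y
  · simp only [place, Matrix.of_apply, if_pos h, Matrix.mul_apply]
    -- Only intermediate configurations that agree with `σ` off the range of `e` contribute; they
    -- are parametrised by their restriction `κ` along `e`.
    refine Finset.sum_of_injOn (fun κ => Function.extend e κ σ)
      (fun κ _ κ' _ hκ => funext fun i => ?_) (fun _ _ => Finset.mem_coe.2 (Finset.mem_univ _))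
      (fun κ _ hκ => ?_) (fun κ _ => ?_)
    · simpa [he.extend_apply] using congrFun hκ (e i)
    · have : ¬ ∀ y, y ∉ Set.range e → σ y = κ y := by
        refine fun h' => hκ ⟨κ ∘ e, Finset.mem_coe.2 (Finset.mem_univ _), funext fun y => ?_⟩
        by_cases hy : y ∈ Set.range e
        · obtain ⟨i, rfl⟩ := hy
          simp [he.extend_apply]
        · simp only [Function.extend_apply' _ _ _ hy, h' y hy]
      rw [if_neg this, zero_mul]
    · have h1 : Function.extend e κ σ ∘ e = κ := funext fun i => he.extend_apply _ _ _
      have h2 : ∀ y, y ∉ Set.range e → Function.extend e κ σ y = σ y := fun y hy =>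
        Function.extend_apply' _ _ _ hy
      rw [if_pos fun y hy => (h2 y hy).symm, if_pos fun y hy => (h2 y hy).trans (h y hy), h1]
  · simp only [place, Matrix.of_apply, if_neg h]
    refine (Finset.sum_eq_zero fun κ _ => ?_).symm
    by_cases h1 : ∀ y, y ∉ Set.range e → σ y = κ y
    · rw [if_neg (c := ∀ y, y ∉ Set.range e → κ y = τ y), mul_zero]
      exact fun h2 => h fun y hy => (h1 y hy).trans (h2 y hy)
    · rw [if_neg h1, zero_mul]

theorem place_place {e : I → Y} {e' : Y → Z} (he' : e'.Injective)
    (A : Matrix (I → Fin k) (I → Fin k) ℂ) : place e' (place e A) = place (e' ∘ e) A := by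
  ext σ τ
  simp only [place, Matrix.of_apply]
  by_cases h : ∀ z, z ∉ Set.range (e' ∘ e) → σ z = τ z
  · rw [if_pos h, if_pos, if_pos, Function.comp_assoc, Function.comp_assoc]
    · refine fun y hy => h _ ?_
      rintro ⟨i, hi⟩
      exact hy ⟨i, he' hi⟩
    · refine fun z hz => h z ?_
      rintro ⟨i, rfl⟩
      exact hz ⟨e i, rfl⟩
  · rw [if_neg h]
    split_ifs with h1 h2
    · refine absurd (fun z hz => ?_) h
      by_cases hz' : z ∈ Set.range e'
      · obtain ⟨y, rfl⟩ := hz'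
        refine h2 y ?_
        rintro ⟨i, rfl⟩
        exact hz ⟨i, rfl⟩
      · exact h1 z hz'
    · rfl
    · rfl

/-- `place e` as a homomorphism of star algebras. -/
def placeHom [Fintype I] [DecidableEq I] [Fintype Y] [DecidableEq Y] {e : I → Y}
    (he : e.Injective) :
    Matrix (I → Fin k) (I → Fin k) ℂ →⋆ₙₐ[ℂ] Matrix (Y → Fin k) (Y → Fin k) ℂ where
  toFun := place e
  map_smul' c A := place_smul e c A
  map_zero' := place_zero e
  map_add' := place_add e
  map_mul' := place_mul he
  map_star' := place_star e

/-- Homomorphisms of C⋆-algebras are contractive. -/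
theorem norm_place_le [Fintype I] [DecidableEq I] [Fintype Y] [DecidableEq Y] {e : I → Y}
    (he : e.Injective) (A : Matrix (I → Fin k) (I → Fin k) ℂ) : ‖place e A‖ ≤ ‖A‖ :=
  NonUnitalStarAlgHom.norm_apply_le (placeHom he) A

end Place

/-! ### Local Hamiltonians -/

section LocalHamiltonian

variable {d k : ℕ}

theorem vertexStar_eq (x : Site d) (u : StarIdx d) : vertexStar x u = x + vertexStar 0 u := by
  rcases u with _ | ⟨i, _ | _⟩ <;> simp [vertexStar, sub_eq_add_neg]

theorem vertexStar_injective (x : Site d) : (vertexStar x).Injective := by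
  intro u v h
  rw [vertexStar_eq, vertexStar_eq x v, add_right_inj] at h
  rcases u with _ | ⟨i, _ | _⟩ <;> rcases v with _ | ⟨j, _ | _⟩ <;>
    have hi := fun i => congrFun h i <;> simp only [vertexStar, zero_add, zero_sub] at hi
  · rfl
  · simpa using hi j
  · simpa using hi j
  · simpa using hi i
  · have := hi i
    by_cases hij : i = j
    · rw [hij]
    · simp [hij] at this
  · have := hi i
    simp only [Pi.neg_apply, Pi.single_apply] at this
    split_ifs at this
  · simpa using hi i
  · have := hi i
    simp only [Pi.neg_apply, Pi.single_apply] at this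
    split_ifs at this <;> simp at this
  · have := hi i
    by_cases hij : i = j
    · rw [hij]
    · simp [hij] at this

/-- The vertices whose star may meet the star of `x`. -/
def nearby (x : Site d) : Finset (Site d) :=
  Finset.univ.image fun uv : StarIdx d × StarIdx d => x + vertexStar 0 uv.1 - vertexStar 0 uv.2

theorem card_nearby_le (x : Site d) : (nearby x).card ≤ Fintype.card (StarIdx d × StarIdx d) :=
  Finset.card_image_le

theorem mem_nearby {x y : Site d} {u v : StarIdx d} (h : vertexStar x u = vertexStar y v) :
    y ∈ nearby x := by
  refine Finset.mem_image.2 ⟨(u, v), Finset.mem_univ _, ?_⟩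
  rw [vertexStar_eq x, vertexStar_eq y] at h
  simp only [h, add_sub_cancel_right]

variable (S : Matrix (StarIdx d → Fin k) (StarIdx d → Fin k) ℂ)

/-- `S_x` in the `L`-th volume, taken to be `0` for `x` outside the box. -/
def boxTerm (x : Site d) (L : ℕ) : Matrix (Config d k L) (Config d k L) ℂ :=
  if h : x ∈ box d L then localTerm S L ⟨x, h⟩ else 0

theorem norm_boxTerm_le (x : Site d) (L : ℕ) : ‖boxTerm S x L‖ ≤ ‖S‖ := by
  rw [boxTerm]
  split_ifs with h
  · exact norm_place_le (fun u v huv => vertexStar_injective x (congrArg Subtype.val huv)) S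
  · simp

variable {S} in
theorem boxTerm_isSelfAdjoint (hS : S.IsHermitian) (x : Site d) (L : ℕ) :
    IsSelfAdjoint (boxTerm S x L) := by
  rw [boxTerm]
  split_ifs with h
  · exact place_isHermitian _ hS
  · exact IsSelfAdjoint.zero _

theorem boxTerm_commute {x y : Site d} (h : y ∉ nearby x) (L : ℕ) :
    Commute (boxTerm S x L) (boxTerm S y L) := by
  rw [boxTerm, boxTerm]
  split_ifs with hx hy
  · refine place_commute _ _ (Set.disjoint_left.2 ?_) _ _
    rintro _ ⟨u, rfl⟩ ⟨v, hv⟩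
    exact h (mem_nearby (congrArg Subtype.val hv).symm)
  · exact Commute.zero_right _
  · exact Commute.zero_left _
  · exact Commute.zero_left _

theorem extend_boxTerm {x : Site d} {L M : ℕ} (h : L ≤ M) (hx : x ∈ box d L) :
    extend h (boxTerm S x L) = boxTerm S x M := by
  have hx' : x ∈ box d M := by
    simp only [box, Finset.mem_Icc, Pi.le_def] at hx ⊢
    refine ⟨fun i => (hx.1 i).trans' ?_, fun i => (hx.2 i).trans ?_⟩
    · exact neg_le_neg (Int.ofNat_le.2 h)
    · exact Int.ofNat_le.2 h
  rw [boxTerm, boxTerm, dif_pos hx, dif_pos hx', extend, localTerm, place_place]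
  · rfl
  · exact fun y z hyz => Subtype.ext (congrArg (fun w : sites d M => w.1) hyz)

theorem exists_mem_box (x : Site d) : ∃ N, ∀ L, N ≤ L → x ∈ box d L := by
  refine ⟨∑ i, (x i).natAbs, fun L hL => ?_⟩
  have h : ∀ i, (x i).natAbs ≤ L := fun i =>
    (Finset.single_le_sum (f := fun i => (x i).natAbs) (fun _ _ => Nat.zero_le _)
      (Finset.mem_univ i)).trans hL
  simp only [box, Finset.mem_Icc, Pi.le_def]
  exact ⟨fun i => by have := h i; omega, fun i => by have := h i; omega⟩

/-- The Hamiltonian `∑ c_x S_x` in the `L`-th volume. -/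
def ham (c : Site d → ℂ) (L : ℕ) : Matrix (Config d k L) (Config d k L) ℂ :=
  ∑ x ∈ box d L, c x • boxTerm S x L

theorem ham_add (c c' : Site d → ℂ) (L : ℕ) : ham S (c + c') L = ham S c L + ham S c' L := by
  simp [ham, add_smul, Finset.sum_add_distrib]

theorem ham_smul (z : ℂ) (c : Site d → ℂ) (L : ℕ) : ham S (z • c) L = z • ham S c L := by
  simp [ham, mul_smul, Finset.smul_sum]

variable {S} in
theorem ham_mem_skewAdjoint (hS : S.IsHermitian) {c : Site d → ℂ} (hc : ∀ x, star (c x) = -c x)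
    (L : ℕ) : ham S c L ∈ skewAdjoint (Matrix (Config d k L) (Config d k L) ℂ) := by
  refine sum_mem fun x _ => ?_
  rw [skewAdjoint.mem_iff, star_smul, hc, neg_smul, (boxTerm_isSelfAdjoint hS x L).star_eq]

/-- Terms centred away from `nearby x` commute with `S_x`, and terms outside the box are `0` by
convention. The index set is therefore the same in every volume, as the uniform commutator estimates
require. -/
theorem delta_ham_boxTerm (c : Site d → ℂ) (L : ℕ) (x : Site d) :
    delta (ham S c L) (ham S c L) (boxTerm S x L) =
      ∑ y ∈ nearby x, c y • (boxTerm S y L * boxTerm S x L - boxTerm S x L * boxTerm S y L) := by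
  rw [delta_apply, ham, Finset.sum_mul, Finset.mul_sum, ← Finset.sum_sub_distrib]
  simp only [smul_mul_assoc, mul_smul_comm, ← smul_sub]
  rw [Finset.sum_subset (Finset.subset_union_left (s₂ := nearby x)),
    ← Finset.sum_subset (Finset.subset_union_right (s₁ := box d L))]
  · intro y _ hy
    rw [(boxTerm_commute S hy L).eq, sub_self, smul_zero]
  · intro y _ hy
    rw [boxTerm, dif_neg hy, zero_mul, mul_zero, sub_self, smul_zero]

variable (d) in
/-- A bound for the number of vertices whose star meets a given star. -/
def degreeBound : ℕ := Fintype.card (StarIdx d × StarIdx d)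

/-- The rate of growth of iterated commutators with a Hamiltonian whose coefficients are at
most `C`. -/
def rate (C : ℝ) : ℝ := 2 * degreeBound d * C * ‖S‖

theorem rate_nonneg {C : ℝ} (hC : 0 ≤ C) : 0 ≤ rate S C := by
  unfold rate
  positivity

theorem rate_mul (r C : ℝ) : rate S (r * C) = r * rate S C := by
  unfold rate
  ring

theorem norm_delta_ham_pow_le {c : Site d → ℂ} {C : ℝ} (hc : ∀ x, ‖c x‖ ≤ C) (L n : ℕ)
    (x : Site d) :
    ‖(delta (ham S c L) (ham S c L) ^ n) (boxTerm S x L)‖ ≤ ‖S‖ * (n.factorial * rate S C ^ n) :=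
  norm_delta_pow_le (s := fun x => boxTerm S x L) (delta_ham_boxTerm S c L) card_nearby_le hc
    (fun x => norm_boxTerm_le S x L) ((norm_nonneg _).trans (hc x)) (norm_nonneg _) n x

/-- Conjugation of a local term by the exponential of a small complex local Hamiltonian is
bounded uniformly in the volume. -/
theorem norm_exp_ham_mul_boxTerm_le {c : Site d → ℂ} {C : ℝ} (hc : ∀ x, ‖c x‖ ≤ C)
    (hC : rate S C < 1) (L : ℕ) (x : Site d) :
    ‖NormedSpace.exp (ham S c L) * boxTerm S x L * NormedSpace.exp (-ham S c L)‖ ≤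
      ‖S‖ * (1 - rate S C)⁻¹ :=
  norm_exp_mul_mul_exp_le (norm_delta_ham_pow_le S hc L · x)
    (rate_nonneg S ((norm_nonneg _).trans (hc x))) hC

/-- For small coefficients, the conjugation is close to the identity. -/
theorem norm_exp_ham_mul_boxTerm_sub_le {c : Site d → ℂ} {C : ℝ} (hc : ∀ x, ‖c x‖ ≤ C)
    (hC : rate S C < 1) (L : ℕ) (x : Site d) :
    ‖NormedSpace.exp (ham S c L) * boxTerm S x L * NormedSpace.exp (-ham S c L) -
      boxTerm S x L‖ ≤ ‖S‖ * ((1 - rate S C)⁻¹ - 1) :=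
  norm_exp_mul_mul_exp_sub_le (norm_delta_ham_pow_le S hc L · x)
    (rate_nonneg S ((norm_nonneg _).trans (hc x))) hC

end LocalHamiltonian

/-! ### Sequences generated by the local terms -/

section LocallyGenerated

variable {d k : ℕ}

/-- Sequences of operators in the closed algebra generated by the local terms. -/
inductive LocallyGenerated (S : Matrix (StarIdx d → Fin k) (StarIdx d → Fin k) ℂ) :
    (∀ L, Matrix (Config d k L) (Config d k L) ℂ) → Prop
  | one : LocallyGenerated S fun _ => 1
  | boxTerm (x : Site d) : LocallyGenerated S (boxTerm S x)
  | add {A B} : LocallyGenerated S A → LocallyGenerated S B → LocallyGenerated S fun L => A L + B L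
  | smul (z : ℂ) {A} : LocallyGenerated S A → LocallyGenerated S fun L => z • A L
  | mul {A B} : LocallyGenerated S A → LocallyGenerated S B → LocallyGenerated S fun L => A L * B L
  | limit {A} (B : ℕ → ∀ L, Matrix (Config d k L) (Config d k L) ℂ) :
      (∀ n, LocallyGenerated S (B n)) → (∀ n L, ‖A L - B n L‖ ≤ 1 / ((n : ℝ) + 1)) →
      LocallyGenerated S A

namespace LocallyGenerated

variable {S : Matrix (StarIdx d → Fin k) (StarIdx d → Fin k) ℂ}
  {A B : ∀ L, Matrix (Config d k L) (Config d k L) ℂ}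

theorem of_approx (h : ∀ ε : ℝ, 0 < ε → ∃ B, LocallyGenerated S B ∧ ∀ L, ‖A L - B L‖ ≤ ε) :
    LocallyGenerated S A := by
  choose B hB hAB using fun n : ℕ => h (1 / ((n : ℝ) + 1)) Nat.one_div_pos_of_nat
  exact limit B hB hAB

theorem zero : LocallyGenerated S fun _ => 0 := by
  simpa using smul 0 (one (S := S))

theorem sub (hA : LocallyGenerated S A) (hB : LocallyGenerated S B) :
    LocallyGenerated S fun L => A L - B L := by
  simpa [sub_eq_add_neg] using hA.add (hB.smul (-1))

theorem sum {ι : Type*} (s : Finset ι) {f : ι → ∀ L, Matrix (Config d k L) (Config d k L) ℂ}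
    (hf : ∀ i ∈ s, LocallyGenerated S (f i)) : LocallyGenerated S fun L => ∑ i ∈ s, f i L := by
  classical
  induction s using Finset.induction_on with
  | empty => simpa using zero
  | insert i s hi ih =>
    simp only [Finset.sum_insert hi]
    exact (hf i (Finset.mem_insert_self i s)).add
      (ih fun j hj => hf j (Finset.mem_insert_of_mem hj))

/-- The Weierstrass test: a summable majorant independent of `L` makes the partial sums converge
uniformly in the volume. -/
theorem of_hasSum {ι : Type*} {f : ι → ∀ L, Matrix (Config d k L) (Config d k L) ℂ} {a : ι → ℝ}
    (hf : ∀ i, LocallyGenerated S (f i)) (ha : Summable a) (hfa : ∀ i L, ‖f i L‖ ≤ a i)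
    (hA : ∀ L, HasSum (fun i => f i L) (A L)) : LocallyGenerated S A := by
  classical
  refine of_approx fun ε hε => ?_
  obtain ⟨s, hs⟩ := summable_iff_vanishing_norm.1 ha ε hε
  refine ⟨fun L => ∑ i ∈ s, f i L, sum s fun i _ => hf i, fun L => ?_⟩
  refine le_of_tendsto ((Filter.Tendsto.sub_const (hA L) _).norm) ?_
  filter_upwards [Filter.eventually_ge_atTop s] with t ht
  rw [← Finset.sum_sdiff ht, add_sub_cancel_right]
  refine (norm_sum_le_of_le _ fun i _ => hfa i L).trans ?_
  exact (le_abs_self _).trans (hs _ Finset.sdiff_disjoint).le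

theorem norm_one_le {n : Type} [Fintype n] [DecidableEq n] : ‖(1 : Matrix n n ℂ)‖ ≤ 1 := by
  rcases subsingleton_or_nontrivial (Matrix n n ℂ) with h | h
  · rw [Subsingleton.elim (1 : Matrix n n ℂ) 0, norm_zero]
    exact zero_le_one
  · exact CStarRing.norm_one.le

theorem bounded (hA : LocallyGenerated S A) : ∃ C, 0 < C ∧ ∀ L, ‖A L‖ ≤ C := by
  induction hA with
  | one => exact ⟨1, one_pos, fun L => norm_one_le⟩
  | boxTerm x =>
    exact ⟨‖S‖ + 1, by positivity, fun L => (norm_boxTerm_le S x L).trans (by linarith)⟩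
  | add _ _ ihA ihB =>
    obtain ⟨a, ha, hA⟩ := ihA
    obtain ⟨b, hb, hB⟩ := ihB
    exact ⟨a + b, add_pos ha hb, fun L => (norm_add_le _ _).trans (add_le_add (hA L) (hB L))⟩
  | smul z _ ihA =>
    obtain ⟨a, ha, hA⟩ := ihA
    refine ⟨(‖z‖ + 1) * a, by positivity, fun L => ?_⟩
    rw [norm_smul]
    exact mul_le_mul (by linarith) (hA L) (norm_nonneg _) (by positivity)
  | mul _ _ ihA ihB =>
    obtain ⟨a, ha, hA⟩ := ihA
    obtain ⟨b, hb, hB⟩ := ihB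
    exact ⟨a * b, mul_pos ha hb, fun L => (norm_mul_le _ _).trans
      (mul_le_mul (hA L) (hB L) (norm_nonneg _) ha.le)⟩
  | @limit A B _ h ih =>
    -- One approximant suffices; the one of index `0` is within distance `1`.
    obtain ⟨b, hb, hB⟩ := ih 0
    refine ⟨1 + b, by positivity, fun L => ?_⟩
    rw [← sub_add_cancel (A L) (B 0 L)]
    exact (norm_add_le _ _).trans (add_le_add (by simpa using h 0 L) (hB L))

theorem star_apply (hS : S.IsHermitian) (hA : LocallyGenerated S A) :
    LocallyGenerated S fun L => star (A L) := by
  induction hA with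
  | one => simpa using one
  | boxTerm x => simpa only [(boxTerm_isSelfAdjoint hS x _).star_eq] using boxTerm x
  | add _ _ ihA ihB => simpa only [star_add] using ihA.add ihB
  | smul z _ ihA => simpa only [star_smul] using ihA.smul (star z)
  | mul _ _ ihA ihB => simpa only [star_mul] using ihB.mul ihA
  | limit B _ h ih => exact limit _ ih fun n L => by simpa only [← star_sub, norm_star] using h n L

theorem extend_injective {L M : ℕ} (h : L ≤ M) :
    Function.Injective fun y : sites d L => (⟨y.1, sites_mono h y.2⟩ : sites d M) :=
  fun _ _ hyz => Subtype.ext (congrArg (fun w : sites d M => w.1) hyz)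

theorem extend_sub {L M : ℕ} (h : L ≤ M) (X Y : Matrix (Config d k L) (Config d k L) ℂ) :
    extend h (X - Y) = extend h X - extend h Y :=
  map_sub (placeHom (extend_injective h)) X Y

theorem extend_mul {L M : ℕ} (h : L ≤ M) (X Y : Matrix (Config d k L) (Config d k L) ℂ) :
    extend h (X * Y) = extend h X * extend h Y :=
  place_mul (extend_injective h) X Y

theorem norm_extend_le {L M : ℕ} (h : L ≤ M) (X : Matrix (Config d k L) (Config d k L) ℂ) :
    ‖extend h X‖ ≤ ‖X‖ :=
  norm_place_le (extend_injective h) X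

/-- Sequences generated by the local terms define elements of the quasi-local algebra. -/
theorem cauchy (hA : LocallyGenerated S A) : ∀ ε : ℝ, 0 < ε → ∃ N, ∀ L M, N ≤ L → ∀ h : L ≤ M,
    ‖A M - extend h (A L)‖ < ε := by
  induction hA with
  | one =>
    refine fun ε hε => ⟨0, fun L M _ h => ?_⟩
    rw [extend, place_one, sub_self, norm_zero]
    exact hε
  | boxTerm x =>
    refine fun ε hε => ?_
    obtain ⟨N, hN⟩ := exists_mem_box x
    refine ⟨N, fun L M hL h => ?_⟩
    rw [extend_boxTerm S h (hN L hL), sub_self, norm_zero]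
    exact hε
  | @add A B _ _ ihA ihB =>
    refine fun ε hε => ?_
    obtain ⟨N, hN⟩ := ihA (ε / 2) (by positivity)
    obtain ⟨N', hN'⟩ := ihB (ε / 2) (by positivity)
    refine ⟨max N N', fun L M hL h => ?_⟩
    rw [extend, place_add, add_sub_add_comm]
    have h1 := hN L M ((le_max_left _ _).trans hL) h
    have h2 := hN' L M ((le_max_right _ _).trans hL) h
    exact (norm_add_le _ _).trans_lt ((add_lt_add h1 h2).trans_eq (by ring))
  | @smul z A _ ihA =>
    refine fun ε hε => ?_
    obtain ⟨N, hN⟩ := ihA (ε / (‖z‖ + 1)) (by positivity)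
    refine ⟨N, fun L M hL h => ?_⟩
    rw [extend, place_smul, ← smul_sub, norm_smul]
    have h1 := hN L M hL h
    rw [lt_div_iff₀ (by positivity)] at h1
    refine lt_of_le_of_lt ?_ h1
    rw [mul_comm]
    exact mul_le_mul_of_nonneg_left (by linarith) (norm_nonneg _)
  | @mul A B hA hB ihA ihB =>
    refine fun ε hε => ?_
    obtain ⟨a, ha, hAa⟩ := hA.bounded
    obtain ⟨b, hb, hBb⟩ := hB.bounded
    obtain ⟨N, hN⟩ := ihA (ε / (2 * b)) (by positivity)
    obtain ⟨N', hN'⟩ := ihB (ε / (2 * a)) (by positivity)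
    refine ⟨max N N', fun L M hL h => ?_⟩
    have h1 := hN L M ((le_max_left _ _).trans hL) h
    have h2 := hN' L M ((le_max_right _ _).trans hL) h
    have h3 : A M * B M - extend h (A L * B L) =
        A M * (B M - extend h (B L)) + (A M - extend h (A L)) * extend h (B L) := by
      rw [extend_mul]
      noncomm_ring
    rw [h3]
    calc _ ≤ a * ‖B M - extend h (B L)‖ + ‖A M - extend h (A L)‖ * b := by
          refine (norm_add_le _ _).trans (add_le_add ((norm_mul_le _ _).trans ?_)
            ((norm_mul_le _ _).trans ?_))
          · exact mul_le_mul_of_nonneg_right (hAa M) (norm_nonneg _)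
          · exact mul_le_mul_of_nonneg_left ((norm_extend_le h _).trans (hBb L)) (norm_nonneg _)
      _ < a * (ε / (2 * a)) + ε / (2 * b) * b := by gcongr
      _ = ε := by field_simp; ring
  | @limit A B _ hAB ih =>
    refine fun ε hε => ?_
    obtain ⟨n, hn⟩ := exists_nat_one_div_lt (show 0 < ε / 3 by positivity)
    obtain ⟨N, hN⟩ := ih n (ε / 3) (by positivity)
    refine ⟨N, fun L M hL h => ?_⟩
    have h3 : A M - extend h (A L) = (A M - B n M) + (B n M - extend h (B n L)) -
        extend h (A L - B n L) := by
      rw [extend_sub]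
      abel
    have h4 := (norm_extend_le h _).trans (hAB n L)
    have h5 := norm_sub_le ((A M - B n M) + (B n M - extend h (B n L))) (extend h (A L - B n L))
    have h6 := norm_add_le (A M - B n M) (B n M - extend h (B n L))
    rw [h3]
    linarith [hAB n M, hN L M hL h]

/-- The element of the quasi-local algebra defined by a sequence generated by the local terms. -/
def toQuasiLocal (hA : LocallyGenerated S A) : QuasiLocal d k := ⟨A, hA.cauchy⟩

end LocallyGenerated

end LocallyGenerated

/-! ### Dynamics in the thermodynamic limit -/

section Dynamics

open NormedSpace (exp)

variable {d k : ℕ} {S : Matrix (StarIdx d → Fin k) (StarIdx d → Fin k) ℂ}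

theorem norm_exp_mul_mul_exp_of_skewAdjoint {n : Type} [Fintype n] [DecidableEq n]
    {K K' : Matrix n n ℂ} (hK : K ∈ skewAdjoint (Matrix n n ℂ))
    (hK' : K' ∈ skewAdjoint (Matrix n n ℂ)) (X : Matrix n n ℂ) :
    ‖exp K * X * exp (-K')‖ = ‖X‖ := by
  let _ : NormedAlgebra ℚ (Matrix n n ℂ) := NormedAlgebra.restrictScalars ℚ ℂ _
  rw [CStarRing.norm_mul_mem_unitary _
      (NormedSpace.exp_mem_unitary_of_mem_skewAdjoint (neg_mem hK')),
    CStarRing.norm_mem_unitary_mul _ (NormedSpace.exp_mem_unitary_of_mem_skewAdjoint hK)]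

theorem exp_mul_mul_exp_mul {n : Type} [Fintype n] [DecidableEq n] (K X Y : Matrix n n ℂ) :
    exp K * (X * Y) * exp (-K) = exp K * X * exp (-K) * (exp K * Y * exp (-K)) := by
  calc _ = exp K * X * 1 * Y * exp (-K) := by noncomm_ring
    _ = _ := by rw [← exp_neg_mul_exp K]; noncomm_ring

namespace LocallyGenerated

theorem delta_pow_mul {A B C X Y : ∀ L, Matrix (Config d k L) (Config d k L) ℂ} {n : ℕ}
    (hX : ∀ i ≤ n, LocallyGenerated S fun L => (delta (A L) (B L) ^ i) (X L))
    (hY : ∀ i ≤ n, LocallyGenerated S fun L => (delta (B L) (C L) ^ i) (Y L)) :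
    LocallyGenerated S fun L => (delta (A L) (C L) ^ n) (X L * Y L) := by
  simp only [fun L => OpenSpin.delta_pow_mul (A L) (B L) (C L) (X L) (Y L) n,
    ← Nat.cast_smul_eq_nsmul ℂ]
  refine sum _ fun ij hij => ?_
  have hij' := Finset.HasAntidiagonal.mem_antidiagonal.1 hij
  exact ((hX _ (by omega)).mul (hY _ (by omega))).smul _

/-- The Hamiltonian itself need not be locally generated, but its commutator with a local term is a
finite combination of products of local terms, with an index set independent of `L`. -/
theorem delta_ham_pow (c : Site d → ℂ) (n : ℕ) : ∀ x, LocallyGenerated S fun L =>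
    (delta (ham S c L) (ham S c L) ^ n) (OpenSpin.boxTerm S x L) := by
  induction n using Nat.strong_induction_on with
  | _ n ih =>
    intro x
    cases n with
    | zero => simpa using boxTerm x
    | succ n =>
      have key : ∀ y z, LocallyGenerated S fun L => (delta (ham S c L) (ham S c L) ^ n)
          (OpenSpin.boxTerm S y L * OpenSpin.boxTerm S z L) := fun y z =>
        delta_pow_mul (fun i hi => ih i (by omega) y) (fun i hi => ih i (by omega) z)
      simp only [pow_succ, mul_apply_eq_comp, delta_ham_boxTerm, map_sum, map_smul, map_sub]
      exact sum _ fun y _ => ((key y x).sub (key x y)).smul _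

/-- Summability of `v` allows the bounds for the single local terms to be added over all sites,
uniformly in `L`, while `c` need only be bounded. -/
theorem delta_ham_pow_ham {c v : Site d → ℂ} {C : ℝ} (hc : ∀ x, ‖c x‖ ≤ C)
    (hv : Summable fun x => ‖v x‖) (n : ℕ) :
    LocallyGenerated S (fun L => (delta (ham S c L) (ham S c L) ^ n) (ham S v L)) ∧
      ∀ L, ‖(delta (ham S c L) (ham S c L) ^ n) (ham S v L)‖ ≤
        (∑' x, ‖v x‖) * ‖S‖ * (n.factorial * rate S C ^ n) := by
  have hle : ∀ x L, ‖v x • (delta (ham S c L) (ham S c L) ^ n) (OpenSpin.boxTerm S x L)‖ ≤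
      ‖v x‖ * (‖S‖ * (n.factorial * rate S C ^ n)) := fun x L => by
    rw [norm_smul]
    exact mul_le_mul_of_nonneg_left (norm_delta_ham_pow_le S hc L n x) (norm_nonneg _)
  have hsum : ∀ L, HasSum
      (fun x => v x • (delta (ham S c L) (ham S c L) ^ n) (OpenSpin.boxTerm S x L))
      ((delta (ham S c L) (ham S c L) ^ n) (ham S v L)) := fun L => by
    simp only [ham, map_sum, map_smul]
    refine hasSum_sum_of_ne_finset_zero fun x hx => ?_
    rw [OpenSpin.boxTerm, dif_neg hx, map_zero, smul_zero]
  refine ⟨of_hasSum (fun x => (delta_ham_pow c n x).smul (v x)) (hv.mul_right _) hle hsum,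
    fun L => ?_⟩
  rw [mul_assoc]
  exact (hsum L).norm_le_of_bounded (hv.hasSum.mul_right _) fun x => hle x L

theorem exists_nat_rate_lt_one (r : ℝ) : ∃ n : ℕ, (n : ℂ) ≠ 0 ∧ (n : ℝ)⁻¹ * r < 1 := by
  obtain ⟨n, hn⟩ := exists_nat_gt (max r 0)
  have h0 : (0 : ℝ) < n := (le_max_right _ _).trans_lt hn
  refine ⟨n, by exact_mod_cast h0.ne', ?_⟩
  rw [inv_mul_lt_iff₀ h0, mul_one]
  exact (le_max_left _ _).trans_lt hn

variable {A : ∀ L, Matrix (Config d k L) (Config d k L) ℂ} {c c' : Site d → ℂ} {C : ℝ}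

/-- Induction on the generation of `A`: local terms are handled by the commutator series, products
by multiplicativity of conjugation, and uniform limits by its isometry, which is where
skew-adjointness enters. -/
theorem exp_conj_of_lt_one (hS : S.IsHermitian) (hc : ∀ x, star (c x) = -c x)
    (hC : ∀ x, ‖c x‖ ≤ C) (hr : rate S C < 1) (hA : LocallyGenerated S A) :
    LocallyGenerated S fun L => exp (ham S c L) * A L * exp (-ham S c L) := by
  induction hA with
  | one => simpa only [mul_one, exp_mul_exp_neg] using one
  | boxTerm x =>
    refine of_hasSum (fun n => (delta_ham_pow c n x).smul (n.factorial : ℂ)⁻¹)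
      ((summable_geometric_of_lt_one (rate_nonneg S ((norm_nonneg _).trans (hC x))) hr).mul_left
        ‖S‖) (fun n L => ?_) fun L => hasSum_exp_mul_mul_exp _ _ _
    exact norm_inv_factorial_smul_le (norm_delta_ham_pow_le S hC L n x)
  | add _ _ ihA ihB => simpa only [mul_add, add_mul] using ihA.add ihB
  | smul z _ ihA => simpa only [mul_smul_comm, smul_mul_assoc] using ihA.smul z
  | mul _ _ ihA ihB => simpa only [exp_mul_mul_exp_mul] using ihA.mul ihB
  | limit B _ h ih =>
    refine limit _ ih fun n L => ?_
    rw [← sub_mul, ← mul_sub, norm_exp_mul_mul_exp_of_skewAdjoint (ham_mem_skewAdjoint hS hc L)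
      (ham_mem_skewAdjoint hS hc L)]
    exact h n L

theorem exp_conj_nsmul
    (h : ∀ A, LocallyGenerated S A →
      LocallyGenerated S fun L => exp (ham S c L) * A L * exp (-ham S c L))
    (hA : LocallyGenerated S A) (n : ℕ) :
    LocallyGenerated S fun L => exp ((n : ℂ) • ham S c L) * A L * exp (-((n : ℂ) • ham S c L)) := by
  induction n with
  | zero => simpa using hA
  | succ n ih =>
    have hc : ∀ L, Commute (ham S c L) ((n : ℂ) • ham S c L) := fun L =>
      (Commute.refl _).smul_right _
    simp only [Nat.cast_succ, add_smul, one_smul, add_comm ((n : ℂ) • _),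
      fun L => exp_add_mul_mul_exp (X := A L) (hc L) (hc L)]
    exact h _ ih

/-- The dynamics of a local Hamiltonian preserves sequences generated by the local terms. -/
theorem exp_conj (hS : S.IsHermitian) (hc : ∀ x, star (c x) = -c x)
    (hC : ∀ x, ‖c x‖ ≤ C) (hA : LocallyGenerated S A) :
    LocallyGenerated S fun L => exp (ham S c L) * A L * exp (-ham S c L) := by
  obtain ⟨n, hn, hr⟩ := exists_nat_rate_lt_one (rate S C)
  -- Dividing the coefficients by a large `n` brings the rate below `1`; `n` such conjugations
  -- compose to the original one.
  have h := exp_conj_nsmul (c := (n : ℂ)⁻¹ • c) (fun A hA => exp_conj_of_lt_one hS (fun x => ?_)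
    (C := (n : ℝ)⁻¹ * C) (fun x => ?_) (by rwa [rate_mul]) hA) hA n
  · simpa only [ham_smul, smul_smul, mul_inv_cancel₀ hn, one_smul] using h
  · simp [hc]
  · rw [Pi.smul_apply, smul_eq_mul, norm_mul, norm_inv, Complex.norm_natCast]
    exact mul_le_mul_of_nonneg_left (hC x) (by positivity)

/-- The dynamics is strongly continuous, uniformly in the volume. -/
theorem exp_conj_continuous (hS : S.IsHermitian) (hA : LocallyGenerated S A) :
    ∀ ε : ℝ, 0 < ε → ∃ δ > 0, ∀ c : Site d → ℂ, (∀ x, star (c x) = -c x) → (∀ x, ‖c x‖ ≤ δ) →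
      ∀ L, ‖exp (ham S c L) * A L * exp (-ham S c L) - A L‖ ≤ ε := by
  induction hA with
  | one =>
    refine fun ε hε => ⟨1, one_pos, fun c _ _ L => ?_⟩
    rw [mul_one, exp_mul_exp_neg, sub_self, norm_zero]
    exact hε.le
  | boxTerm x =>
    intro ε hε
    have hlim : Filter.Tendsto (fun δ : ℝ => ‖S‖ * ((1 - rate S δ)⁻¹ - 1)) (𝓝 0) (𝓝 0) := by
      have h : ContinuousAt (fun δ : ℝ => ‖S‖ * ((1 - rate S δ)⁻¹ - 1)) 0 := by
        have : 1 - rate S 0 ≠ 0 := by simp [rate]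
        have : ContinuousAt (fun δ => rate S δ) 0 := by unfold rate; fun_prop
        fun_prop (disch := assumption)
      simpa [ContinuousAt, rate] using h
    have hlim' : Filter.Tendsto (fun δ : ℝ => rate S δ) (𝓝 0) (𝓝 0) := by
      have : ContinuousAt (fun δ => rate S δ) 0 := by unfold rate; fun_prop
      simpa [ContinuousAt, rate] using this
    obtain ⟨δ, hδ, h⟩ := Metric.eventually_nhds_iff.1
      ((hlim.eventually (gt_mem_nhds hε)).and (hlim'.eventually (gt_mem_nhds one_pos)))
    obtain ⟨h1, h2⟩ := h (y := δ / 2) (by rw [Real.dist_0_eq_abs, abs_of_pos] <;> linarith)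
    exact ⟨δ / 2, half_pos hδ, fun c _ hc L =>
      (norm_exp_ham_mul_boxTerm_sub_le S hc h2 L x).trans h1.le⟩
  | @add A B _ _ ihA ihB =>
    intro ε hε
    obtain ⟨δ, hδ, h⟩ := ihA (ε / 2) (half_pos hε)
    obtain ⟨δ', hδ', h'⟩ := ihB (ε / 2) (half_pos hε)
    refine ⟨min δ δ', lt_min hδ hδ', fun c hc hcδ L => ?_⟩
    have h1 := h c hc (fun x => (hcδ x).trans (min_le_left _ _)) L
    have h2 := h' c hc (fun x => (hcδ x).trans (min_le_right _ _)) L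
    rw [mul_add, add_mul, add_sub_add_comm]
    exact (norm_add_le _ _).trans ((add_le_add h1 h2).trans_eq (by ring))
  | @smul z A _ ihA =>
    intro ε hε
    obtain ⟨δ, hδ, h⟩ := ihA (ε / (‖z‖ + 1)) (by positivity)
    refine ⟨δ, hδ, fun c hc hcδ L => ?_⟩
    have h1 := h c hc hcδ L
    rw [le_div_iff₀ (by positivity)] at h1
    rw [mul_smul_comm, smul_mul_assoc, ← smul_sub, norm_smul, mul_comm]
    exact (mul_le_mul_of_nonneg_left (by linarith) (norm_nonneg _)).trans h1
  | @mul A B hA hB ihA ihB =>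
    intro ε hε
    obtain ⟨a, ha, hAa⟩ := hA.bounded
    obtain ⟨b, hb, hBb⟩ := hB.bounded
    obtain ⟨δ, hδ, h⟩ := ihA (ε / (2 * b)) (by positivity)
    obtain ⟨δ', hδ', h'⟩ := ihB (ε / (2 * a)) (by positivity)
    refine ⟨min δ δ', lt_min hδ hδ', fun c hc hcδ L => ?_⟩
    have h1 := h c hc (fun x => (hcδ x).trans (min_le_left _ _)) L
    have h2 := h' c hc (fun x => (hcδ x).trans (min_le_right _ _)) L
    have hK := ham_mem_skewAdjoint hS hc L
    rw [exp_mul_mul_exp_mul]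
    -- Conjugation is isometric, so the bound on `A` persists and the two errors in the product are
    -- each at most `ε / 2`.
    have h3 : ‖exp (ham S c L) * A L * exp (-ham S c L)‖ ≤ a := by
      rw [norm_exp_mul_mul_exp_of_skewAdjoint hK hK]
      exact hAa L
    set A' := exp (ham S c L) * A L * exp (-ham S c L)
    set B' := exp (ham S c L) * B L * exp (-ham S c L)
    have h4 : A' * B' - A L * B L = A' * (B' - B L) + (A' - A L) * B L := by noncomm_ring
    rw [h4]
    calc _ ≤ a * (ε / (2 * a)) + ε / (2 * b) * b := by
          refine (norm_add_le _ _).trans (add_le_add ((norm_mul_le _ _).trans ?_)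
            ((norm_mul_le _ _).trans ?_))
          · exact mul_le_mul h3 h2 (norm_nonneg _) ha.le
          · exact mul_le_mul h1 (hBb L) (norm_nonneg _) (by positivity)
      _ = ε := by field_simp; ring
  | @limit A B _ hAB ih =>
    intro ε hε
    obtain ⟨n, hn⟩ := exists_nat_one_div_lt (show 0 < ε / 3 by positivity)
    obtain ⟨δ, hδ, h⟩ := ih n (ε / 3) (by positivity)
    refine ⟨δ, hδ, fun c hc hcδ L => ?_⟩
    have hK := ham_mem_skewAdjoint hS hc L
    have h1 := h c hc hcδ L
    have h2 := hAB n L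
    have h3 := norm_exp_mul_mul_exp_of_skewAdjoint hK hK (A L - B n L)
    have h4 : exp (ham S c L) * A L * exp (-ham S c L) - A L =
        exp (ham S c L) * (A L - B n L) * exp (-ham S c L) +
        (exp (ham S c L) * B n L * exp (-ham S c L) - B n L) - (A L - B n L) := by
      noncomm_ring
    rw [h4]
    refine (norm_sub_le _ _).trans ((add_le_add (norm_add_le _ _) le_rfl).trans ?_)
    rw [h3]
    linarith

/-- The cocycle is the series of iterated generalised commutators applied to `1`. The first one
gives `ham S v`, so at each order only the growth of commutators with the unperturbed Hamiltonian
and the `ℓ¹` norm of `v` matter; their sum `Q` is the ratio of the geometric majorant. -/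
theorem exp_mul_exp_of_lt_one {v : Site d → ℂ} (hC : ∀ x, ‖c x‖ ≤ C) (hC0 : 0 ≤ C)
    (hv : Summable fun x => ‖v x‖) (hr : rate S C + (∑' x, ‖v x‖) * ‖S‖ < 1) :
    LocallyGenerated S fun L => exp (ham S (c + v) L) * exp (-ham S c L) := by
  set Q := rate S C + (∑' x, ‖v x‖) * ‖S‖ with hQ
  have hR0 : 0 ≤ rate S C := rate_nonneg S hC0
  have hV0 : 0 ≤ (∑' x, ‖v x‖) * ‖S‖ := by positivity
  have key : ∀ n, (LocallyGenerated S fun L => (delta (ham S (c + v) L) (ham S c L) ^ n) 1) ∧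
      ∀ L, ‖(delta (ham S (c + v) L) (ham S c L) ^ n) 1‖ ≤ 1 * (n.factorial * Q ^ n) := by
    intro n
    induction n using Nat.strong_induction_on with
    | _ n ih =>
      cases n with
      | zero => exact ⟨by simpa using one, fun L => by simpa using norm_one_le⟩
      | succ n =>
        -- The factor `1` is kept so that the Leibniz rule, with `ham S c` in the middle, returns
        -- lower-order terms of the same series times ordinary iterated commutators of `ham S v`.
        have h : ∀ L, delta (ham S (c + v) L) (ham S c L) 1 = 1 * ham S v L := fun L => by
          rw [delta_apply, ham_add, mul_one, one_mul, one_mul, add_sub_cancel_left]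
        simp only [pow_succ (delta _ _), mul_apply_eq_comp, h]
        refine ⟨delta_pow_mul (fun i hi => (ih i (by omega)).1)
          fun i hi => (delta_ham_pow_ham hC hv i).1, fun L => ?_⟩
        refine (norm_delta_pow_mul_le (B := ham S c L) (add_nonneg hR0 hV0) zero_le_one
          (fun i hi => (ih i (by omega)).2 L) fun i _ =>
            ((delta_ham_pow_ham hC hv i).2 L).trans ?_).trans
          (b := 1 * ((∑' x, ‖v x‖) * ‖S‖) * ((n + 1).factorial * Q ^ n)) ?_
        · gcongr
          linarith
        · rw [one_mul, one_mul, pow_succ]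
          have : (∑' x, ‖v x‖) * ‖S‖ ≤ Q := by linarith
          calc _ ≤ Q * ((n + 1).factorial * Q ^ n) := by
                gcongr
            _ = _ := by ring
  refine of_hasSum (fun n => (key n).1.smul (n.factorial : ℂ)⁻¹)
    ((summable_geometric_of_lt_one (add_nonneg hR0 hV0) hr).mul_left 1)
    (fun n L => norm_inv_factorial_smul_le ((key n).2 L)) fun L => ?_
  simpa only [mul_one] using hasSum_exp_mul_mul_exp (ham S (c + v) L) (ham S c L) 1

/-- The cocycle that relates the dynamics of a local Hamiltonian to that of a summable
perturbation is generated by the local terms. -/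
theorem exp_mul_exp {v : Site d → ℂ} (hS : S.IsHermitian) (hc : ∀ x, star (c x) = -c x)
    (hC : ∀ x, ‖c x‖ ≤ C) (hC0 : 0 ≤ C) (hv : Summable fun x => ‖v x‖) :
    LocallyGenerated S fun L => exp (ham S (c + v) L) * exp (-ham S c L) := by
  obtain ⟨n, hn, hr⟩ := exists_nat_rate_lt_one (rate S C + (∑' x, ‖v x‖) * ‖S‖)
  have hC' : ∀ x, ‖((n : ℂ)⁻¹ • c) x‖ ≤ (n : ℝ)⁻¹ * C := fun x => by
    rw [Pi.smul_apply, smul_eq_mul, norm_mul, norm_inv, Complex.norm_natCast]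
    exact mul_le_mul_of_nonneg_left (hC x) (by positivity)
  have hc' : ∀ x, star (((n : ℂ)⁻¹ • c) x) = -((n : ℂ)⁻¹ • c) x := by simp [hc]
  have hv' : ∀ x, ‖((n : ℂ)⁻¹ • v) x‖ = (n : ℝ)⁻¹ * ‖v x‖ := fun x => by
    rw [Pi.smul_apply, smul_eq_mul, norm_mul, norm_inv, Complex.norm_natCast]
  have h1 : LocallyGenerated S fun L =>
      exp (ham S ((n : ℂ)⁻¹ • c + (n : ℂ)⁻¹ • v) L) * exp (-ham S ((n : ℂ)⁻¹ • c) L) := by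
    refine exp_mul_exp_of_lt_one hC' (by positivity) ?_ ?_
    · simpa only [hv'] using hv.mul_left _
    · simp only [hv', tsum_mul_left, rate_mul]
      linarith
  have key : ∀ m : ℕ, LocallyGenerated S fun L =>
      exp ((m : ℂ) • ham S ((n : ℂ)⁻¹ • c + (n : ℂ)⁻¹ • v) L) * 1 *
        exp (-((m : ℂ) • ham S ((n : ℂ)⁻¹ • c) L)) := by
    intro m
    induction m with
    | zero => simpa using one
    | succ m ih =>
      have hcomm : ∀ (b : Site d → ℂ) L, Commute (ham S b L) ((m : ℂ) • ham S b L) := fun b L =>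
        (Commute.refl _).smul_right _
      simp only [Nat.cast_succ, add_smul, one_smul, add_comm ((m : ℂ) • _),
        fun L => exp_add_mul_mul_exp (X := 1) (hcomm ((n : ℂ)⁻¹ • c + (n : ℂ)⁻¹ • v) L)
          (hcomm ((n : ℂ)⁻¹ • c) L)]
      -- With `A` and `B` the perturbed and unperturbed exponents of one step and `X` the product so
      -- far, `e^A X e^{-B} = (e^A e^{-B}) (e^B X e^{-B})`: a small cocycle times an unperturbed
      -- conjugation.
      have h := h1.mul (exp_conj hS hc' hC' ih)
      have h3 : ∀ L, ∀ X : Matrix (Config d k L) (Config d k L) ℂ,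
          exp (-ham S ((n : ℂ)⁻¹ • c) L) * (exp (ham S ((n : ℂ)⁻¹ • c) L) * X) = X := fun L X => by
        rw [← mul_assoc, exp_neg_mul_exp, one_mul]
      simpa only [mul_assoc, h3] using h
  simpa only [← smul_add, ham_smul, smul_smul, mul_inv_cancel₀ hn, one_smul, mul_one] using key n

end LocallyGenerated

end Dynamics

/-! ### The generating function as a trace -/

section GeneratingFunction

open NormedSpace (exp)

theorem exp_mul_of_mul_eq_smul {n : Type} [Fintype n] [DecidableEq n] {A P : Matrix n n ℂ} {z : ℂ}
    (h : A * P = z • P) : exp A * P = Complex.exp z • P := by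
  have hpow : ∀ m : ℕ, A ^ m * P = z ^ m • P := by
    intro m
    induction m with
    | zero => simp
    | succ m ih => rw [pow_succ, mul_assoc, h, mul_smul_comm, ih, smul_smul, pow_succ, mul_comm z]
  have h1 := (NormedSpace.exp_series_hasSum_exp' (𝕂 := ℂ) A).mul_right P
  have h2 := (NormedSpace.exp_series_hasSum_exp' (𝕂 := ℂ) z).smul_const P
  rw [← Complex.exp_eq_exp_ℂ] at h2
  refine h1.unique ?_
  simpa only [smul_mul_assoc, hpow, smul_smul, smul_eq_mul] using h2

open scoped MatrixOrder in
/-- The expectation in a density matrix is bounded by the operator norm. -/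
theorem norm_trace_mul_le {n : Type} [Fintype n] [DecidableEq n] {ρ : Matrix n n ℂ}
    (hρ : ρ.PosSemidef) (htr : ρ.trace = 1) (A : Matrix n n ℂ) : ‖(ρ * A).trace‖ ≤ ‖A‖ := by
  -- Writing `ρ = B^* B` turns the trace into a sum of expectations in the conjugated rows of `B`,
  -- whose squared norms add up to `tr ρ = 1`.
  obtain ⟨B, rfl⟩ := CStarAlgebra.nonneg_iff_eq_star_mul_self.mp hρ.nonneg
  rw [Matrix.star_eq_conjTranspose] at htr ⊢
  let x : n → EuclideanSpace ℂ n := fun i => WithLp.toLp 2 (star (B i))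
  have hx : ∀ (A : Matrix n n ℂ) i, (B * A * B.conjTranspose) i i =
      inner ℂ (x i) (Matrix.toEuclideanCLM (n := n) (𝕜 := ℂ) A (x i)) := by
    intro A i
    rw [EuclideanSpace.inner_eq_star_dotProduct, Matrix.toEuclideanCLM_toLp, mul_assoc,
      Matrix.mul_apply', dotProduct_comm]
    simp only [x, star_star]
    rfl
  have hcyc : ∀ A, (B.conjTranspose * B * A).trace =
      ∑ i, inner ℂ (x i) (Matrix.toEuclideanCLM (n := n) (𝕜 := ℂ) A (x i)) := by
    intro A
    rw [mul_assoc, Matrix.trace_mul_comm, Matrix.trace]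
    exact Finset.sum_congr rfl fun i _ => hx A i
  have hone : ∑ i, ‖x i‖ ^ 2 = 1 := by
    have h := hcyc 1
    rw [mul_one, htr, map_one] at h
    simp only [one_apply_eq_self, inner_self_eq_norm_sq_to_K] at h
    exact Complex.ofReal_injective (by push_cast; exact h.symm)
  rw [hcyc]
  calc _ ≤ ∑ i, ‖A‖ * ‖x i‖ ^ 2 := by
        refine norm_sum_le_of_le _ fun i _ => (norm_inner_le_norm _ _).trans ?_
        have := (Matrix.toEuclideanCLM (n := n) (𝕜 := ℂ) A).le_opNorm (x i)
        rw [Matrix.l2_opNorm_toEuclideanCLM] at this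
        nlinarith [norm_nonneg (x i)]
    _ = ‖A‖ := by rw [← Finset.mul_sum, hone, mul_one]

namespace ConfinedMultisystem

variable {ℓ : ℕ} {n : Type} [Fintype n] [DecidableEq n] (S : ConfinedMultisystem ℓ n)

/-- The observable `E j` as a linear map. -/
abbrev lin (j : Fin ℓ) : Module.End ℂ (EuclideanSpace ℂ n) :=
  (Matrix.toEuclideanCLM (n := n) (𝕜 := ℂ) (S.E j)).toLinearMap

theorem toEuclideanCLM_proj (e : Fin ℓ → ℝ) : Matrix.toEuclideanCLM (n := n) (𝕜 := ℂ) (S.proj e) =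
    (⨅ j, Module.End.eigenspace (S.lin j) (e j : ℂ)).starProjection := by
  rw [proj, StarAlgEquiv.apply_symm_apply]

theorem star_proj (e : Fin ℓ → ℝ) : star (S.proj e) = S.proj e := by
  apply EquivLike.injective (Matrix.toEuclideanCLM (n := n) (𝕜 := ℂ))
  rw [map_star, toEuclideanCLM_proj]
  exact isSelfAdjoint_starProjection _

theorem proj_mul_self (e : Fin ℓ → ℝ) : S.proj e * S.proj e = S.proj e := by
  apply EquivLike.injective (Matrix.toEuclideanCLM (n := n) (𝕜 := ℂ))
  rw [map_mul, toEuclideanCLM_proj]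
  exact Submodule.isIdempotentElem_starProjection _

theorem E_mul_proj (j : Fin ℓ) (e : Fin ℓ → ℝ) : S.E j * S.proj e = (e j : ℂ) • S.proj e := by
  apply EquivLike.injective (Matrix.toEuclideanCLM (n := n) (𝕜 := ℂ))
  rw [map_mul, map_smul, toEuclideanCLM_proj]
  ext1 v
  exact Module.End.mem_eigenspace_iff.1 ((Submodule.mem_iInf _).1
    (Submodule.starProjection_apply_mem
      (⨅ j, Module.End.eigenspace (S.lin j) (e j : ℂ)) v) j)

theorem lin_isSymmetric (j : Fin ℓ) : (S.lin j).IsSymmetric :=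
  ContinuousLinearMap.isSelfAdjoint_iff_isSymmetric.1
    ((S.E_hermitian j).isSelfAdjoint.map (Matrix.toEuclideanCLM (n := n) (𝕜 := ℂ)))

theorem iInf_eigenspace_isOrtho {γ γ' : Fin ℓ → ℂ} (h : γ ≠ γ') :
    (⨅ j, Module.End.eigenspace (S.lin j) (γ j)) ⟂ (⨅ j, Module.End.eigenspace (S.lin j) (γ' j)) :=
  (LinearMap.IsSymmetric.orthogonalFamily_iInf_eigenspaces S.lin_isSymmetric).isOrtho h

theorem ofReal_comp_ne {e e' : Fin ℓ → ℝ} (h : e ≠ e') :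
    (fun j => (e j : ℂ)) ≠ fun j => (e' j : ℂ) :=
  fun h' => h (funext fun j => Complex.ofReal_injective (congrFun h' j))

theorem proj_mul_proj_of_ne {e e' : Fin ℓ → ℝ} (h : e ≠ e') : S.proj e * S.proj e' = 0 := by
  apply EquivLike.injective (Matrix.toEuclideanCLM (n := n) (𝕜 := ℂ))
  rw [map_mul, toEuclideanCLM_proj, toEuclideanCLM_proj, map_zero]
  exact Submodule.starProjection_comp_starProjection_eq_zero_iff.2
    (S.iInf_eigenspace_isOrtho (ofReal_comp_ne h))

/-- Commuting symmetric operators have joint eigenspaces that span the space, so the identity is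
checked on each of them. Eigenvalues are real, hence every nonzero joint eigenspace belongs to an
outcome, and the other projections vanish on it by orthogonality. -/
theorem sum_proj : ∑ e ∈ S.outcomes, S.proj e = 1 := by
  apply EquivLike.injective (Matrix.toEuclideanCLM (n := n) (𝕜 := ℂ))
  rw [map_sum, map_one]
  simp only [toEuclideanCLM_proj]
  ext1 v
  have hcomm : Pairwise (Function.onFun Commute S.lin) := fun i j _ => by
    have h := (S.E_commute i j).map (Matrix.toEuclideanCLM (n := n) (𝕜 := ℂ))
    exact congrArg ContinuousLinearMap.toLinearMap h.eq
  have hv : v ∈ ⨆ γ : Fin ℓ → ℂ, ⨅ j, Module.End.eigenspace (S.lin j) (γ j) := by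
    rw [LinearMap.IsSymmetric.iSup_iInf_eq_top_of_commute S.lin_isSymmetric hcomm]
    exact Submodule.mem_top
  refine Submodule.iSup_induction _ (motive := fun v => (∑ e ∈ S.outcomes,
    (⨅ j, Module.End.eigenspace (S.lin j) (e j : ℂ)).starProjection) v =
      (1 : EuclideanSpace ℂ n →L[ℂ] EuclideanSpace ℂ n) v) hv (fun γ w hw => ?_) ?_ ?_
  · rcases eq_or_ne w 0 with rfl | hw0
    · simp
    have heig : ∀ j, Module.End.HasEigenvalue (S.lin j) (γ j) := fun j =>
      Module.End.hasEigenvalue_of_hasEigenvector ⟨(Submodule.mem_iInf _).1 hw j, hw0⟩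
    obtain ⟨e, rfl⟩ : ∃ e : Fin ℓ → ℝ, γ = fun j => (e j : ℂ) :=
      ⟨fun j => (γ j).re, funext fun j =>
        (Complex.conj_eq_iff_re.1 ((S.lin_isSymmetric j).conj_eigenvalue_eq_self (heig j))).symm⟩
    have he : e ∈ S.outcomes := by
      rw [outcomes, Fintype.mem_piFinset]
      intro j
      rw [Set.Finite.mem_toFinset, ← spectrum.algebraMap_mem_iff ℂ]
      have h := (heig j).mem_spectrum
      rwa [← Matrix.spectrum_toLpLin 2]
    rw [sum_apply, Finset.sum_eq_single_of_mem e he]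
    · exact Submodule.starProjection_eq_self_iff.2 hw
    · intro e' _ hne
      rw [Submodule.starProjection_apply_eq_zero_iff]
      exact S.iInf_eigenspace_isOrtho (ofReal_comp_ne hne.symm) hw
  · simp
  · intro x y hx hy
    rw [map_add, map_add, hx, hy]

/-- `α.E = ∑ j, α_j H_j`. -/
def lc (α : Fin ℓ → ℂ) : Matrix n n ℂ := ∑ j, α j • S.E j

theorem exp_lc_mul_proj (α : Fin ℓ → ℂ) (e : Fin ℓ → ℝ) :
    exp (S.lc α) * S.proj e = Complex.exp (∑ j, α j * e j) • S.proj e := by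
  apply exp_mul_of_mul_eq_smul
  simp only [lc, Finset.sum_mul, smul_mul_assoc, E_mul_proj, smul_smul, Finset.sum_smul]

theorem exp_lc_eq_sum (α : Fin ℓ → ℂ) :
    exp (S.lc α) = ∑ e ∈ S.outcomes, Complex.exp (∑ j, α j * e j) • S.proj e := by
  rw [← mul_one (exp _), ← S.sum_proj, Finset.mul_sum]
  exact Finset.sum_congr rfl fun e _ => S.exp_lc_mul_proj α e

theorem commute_exp_lc_proj (α : Fin ℓ → ℂ) (e : Fin ℓ → ℝ) :
    Commute (exp (S.lc α)) (S.proj e) := by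
  rw [exp_lc_eq_sum]
  refine Commute.sum_left _ _ _ fun e' _ => Commute.smul_left ?_ _
  rcases eq_or_ne e' e with rfl | h
  · exact Commute.refl _
  · rw [commute_iff_eq, S.proj_mul_proj_of_ne h, S.proj_mul_proj_of_ne h.symm]

theorem star_U (t : ℝ) : star (S.U t) = S.U (-t) := by
  have hH : star S.H = S.H := by
    rw [H, star_add, star_sum, S.V_hermitian.isSelfAdjoint.star_eq]
    simp only [fun j => (S.E_hermitian j).isSelfAdjoint.star_eq]
  rw [U, U, NormedSpace.star_exp, star_smul, hH]
  congr 2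
  simp

theorem aprioriState_mul_proj {e : Fin ℓ → ℝ} (he : e ∈ S.outcomes) :
    S.aprioriState * S.proj e = S.proj e * S.ρ * S.proj e := by
  rw [aprioriState, Finset.sum_mul, Finset.sum_eq_single_of_mem e he]
  · rw [mul_assoc, S.proj_mul_self]
  · intro e' _ h
    rw [mul_assoc, S.proj_mul_proj_of_ne h, mul_zero]

/-- By cyclicity this is the trace of `X ρ X^*` with `X = P_{e'} U(-t) P_e`. Positivity in the
complex order also gives that the trace is real. -/
theorem trace_nonneg (t : ℝ) {e : Fin ℓ → ℝ} (he : e ∈ S.outcomes) (e' : Fin ℓ → ℝ) :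
    0 ≤ (S.U (-t) * (S.aprioriState * S.proj e) * S.U t * S.proj e').trace := by
  have h := (S.ρ_posSemidef.mul_mul_conjTranspose_same
    (S.proj e' * S.U (-t) * S.proj e)).trace_nonneg
  rw [← Matrix.star_eq_conjTranspose, star_mul, star_mul, star_proj, star_proj, star_U,
    neg_neg] at h
  have h2 : S.proj e' * S.U (-t) * S.proj e * S.ρ * (S.proj e * (S.U t * S.proj e')) =
      S.proj e' * (S.U (-t) * (S.proj e * S.ρ * S.proj e) * S.U t * S.proj e') := by
    simp only [mul_assoc]
  rwa [h2, Matrix.trace_mul_comm, mul_assoc (_ * S.U t), proj_mul_self,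
    ← S.aprioriState_mul_proj he] at h

theorem ofReal_jointProb (t : ℝ) {e : Fin ℓ → ℝ} (he : e ∈ S.outcomes) (e' : Fin ℓ → ℝ) :
    (S.jointProb t e e' : ℂ) =
      (S.U (-t) * (S.aprioriState * S.proj e) * S.U t * S.proj e').trace :=
  (Complex.eq_re_of_ofReal_le (S.trace_nonneg t he e')).symm

theorem U_zero : S.U 0 = 1 := by
  rw [U, Complex.ofReal_zero, mul_zero, zero_smul, NormedSpace.exp_zero]

theorem χ_eq_sum (t : ℝ) (α : Fin ℓ → ℂ) :
    S.χ t α = ∑ e ∈ S.outcomes, ∑ e' ∈ S.outcomes, (S.jointProb t e e' : ℂ) *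
      (Complex.exp (∑ j, α j * e j) * Complex.exp (∑ j, -α j * e' j)) := by
  have hint : ∀ (f : (Fin ℓ → ℝ) → ℂ) a (r : ℝ), MeasureTheory.Integrable f
      (ENNReal.ofReal r • MeasureTheory.Measure.dirac a) := fun f a r =>
    (MeasureTheory.integrable_dirac (by simp)).smul_measure ENNReal.ofReal_ne_top
  rw [χ, law, MeasureTheory.integral_finsetSum_measure fun e _ =>
    MeasureTheory.integrable_finsetSum_measure.2 fun e' _ => hint _ _ _]
  refine Finset.sum_congr rfl fun e he => ?_
  rw [MeasureTheory.integral_finsetSum_measure fun e' _ => hint _ _ _]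
  refine Finset.sum_congr rfl fun e' _ => ?_
  have hp : 0 ≤ S.jointProb t e e' := (Complex.nonneg_iff.1 (S.trace_nonneg t he e')).1
  rw [MeasureTheory.integral_smul_measure, MeasureTheory.integral_dirac, ENNReal.toReal_ofReal hp,
    Complex.real_smul, ← Complex.exp_add, ← Finset.sum_add_distrib, Finset.mul_sum]
  -- For `t ≠ 0` the factor `t` cancels the one in the rate. At `t = 0` the integrand is `1`, and
  -- both sides agree because distinct outcomes then have joint probability `0`.
  rcases eq_or_ne t 0 with rfl | ht
  · rcases eq_or_ne e e' with rfl | hne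
    · simp
    · have : S.jointProb 0 e e' = 0 := by
        rw [jointProb, neg_zero, U_zero, one_mul, mul_one, mul_assoc, proj_mul_proj_of_ne S hne,
          mul_zero, Matrix.trace_zero, Complex.zero_re]
      rw [this, Complex.ofReal_zero, zero_mul, zero_mul]
  · congr 2
    refine Finset.sum_congr rfl fun j _ => ?_
    have ht' : (t : ℂ) ≠ 0 := Complex.ofReal_ne_zero.2 ht
    simp only [Pi.smul_apply, Pi.sub_apply, smul_eq_mul]
    push_cast
    field_simp
    ring

/-- The generating function of a state that is invariant under the reservoirs. -/
theorem χ_eq_trace (hρ : ∀ e, Commute S.ρ (S.proj e)) (t : ℝ) (α : Fin ℓ → ℂ) :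
    S.χ t α = (S.ρ * (exp (S.lc α) * S.U t * exp (-S.lc α) * S.U (-t))).trace := by
  have hneg : -S.lc α = S.lc (-α) := by simp [lc]
  rw [χ_eq_sum, Matrix.trace_mul_comm, mul_assoc _ (S.U (-t)), Matrix.trace_mul_comm]
  rw [show S.U (-t) * S.ρ * (exp (S.lc α) * S.U t * exp (-S.lc α)) =
    S.U (-t) * (S.ρ * exp (S.lc α)) * S.U t * exp (-S.lc α) by simp only [mul_assoc]]
  rw [hneg, exp_lc_eq_sum, exp_lc_eq_sum]
  simp only [Finset.mul_sum, Finset.sum_mul, Matrix.trace_sum]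
  rw [Finset.sum_comm]
  refine Finset.sum_congr rfl fun e' _ => Finset.sum_congr rfl fun e he => ?_
  rw [S.ofReal_jointProb t he, S.aprioriState_mul_proj he, ← (hρ e).eq, mul_assoc S.ρ,
    S.proj_mul_self]
  simp only [mul_smul_comm, smul_mul_assoc, Matrix.trace_smul, smul_eq_mul, Pi.neg_apply]
  ring

theorem commute_lc (α α' : Fin ℓ → ℂ) : Commute (S.lc α) (S.lc α') :=
  Commute.sum_left _ _ _ fun i _ => Commute.sum_right _ _ _ fun j _ =>
    ((S.E_commute i j).smul_left _).smul_right _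

theorem star_lc (a : Fin ℓ → ℝ) :
    star (S.lc fun j => Complex.I * (a j : ℂ)) = -S.lc fun j => Complex.I * (a j : ℂ) := by
  simp [lc, (S.E_hermitian _).isSelfAdjoint.star_eq]

/-- On the imaginary axis, the generating function is expressed through the cocycle
`exp (i t H) exp (- i t H_0)`. -/
theorem χ_eq_trace_cocycle (hρ : ∀ e, Commute S.ρ (S.proj e)) (t : ℝ) (a : Fin ℓ → ℝ) :
    S.χ t (fun j => Complex.I * (a j : ℂ)) =
      (S.ρ * (exp (S.lc fun j => Complex.I * (a j : ℂ)) *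
        (S.U t * exp (-S.lc fun _ => Complex.I * (t : ℂ))) *
        exp (-S.lc fun j => Complex.I * (a j : ℂ)) *
        star (S.U t * exp (-S.lc fun _ => Complex.I * (t : ℂ))))).trace := by
  have hskew := S.star_lc fun _ => t
  have hcomm := S.commute_lc (fun j => Complex.I * (a j : ℂ)) (fun _ => Complex.I * (t : ℂ))
  rw [S.χ_eq_trace hρ]
  set K := S.lc fun j => Complex.I * (a j : ℂ)
  set K₀ := S.lc fun _ => Complex.I * (t : ℂ)
  let _ : NormedAlgebra ℚ (Matrix n n ℂ) := NormedAlgebra.restrictScalars ℚ ℂ _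
  have hcomm' : exp (-K₀) * exp (-K) = exp (-K) * exp (-K₀) :=
    hcomm.symm.neg_right.neg_left.exp.eq
  -- The free evolution commutes with `e^{-K}` and may be inserted around it, which replaces `U t`
  -- by the cocycle on both sides.
  have h : exp (-K₀) * exp (-K) * exp K₀ = exp (-K) := by
    rw [hcomm', mul_assoc, exp_neg_mul_exp, mul_one]
  rw [star_mul, S.star_U, NormedSpace.star_exp, star_neg, hskew, neg_neg]
  calc _ = (S.ρ * (exp K * S.U t * (exp (-K₀) * exp (-K) * exp K₀) * S.U (-t))).trace := by rw [h]
    _ = _ := by simp only [mul_assoc]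

end ConfinedMultisystem

end GeneratingFunction

/-! ### The open quantum spin system -/

section SpinSystem

open NormedSpace (exp)

variable {d k ℓ : ℕ}

open Classical in
/-- The coefficients of `∑ j, α_j H_j`. -/
def reservoirCoeff (p : Site d → Fin ℓ) (α : Fin ℓ → ℂ) (x : Site d) : ℂ :=
  if x ∈ boundary p then 0 else α (p x)

open Classical in
/-- The coefficients of the interaction. -/
def interactionCoeff (p : Site d → Fin ℓ) (J : Site d → ℝ) (x : Site d) : ℂ :=
  if x ∈ boundary p then (J x : ℂ) else 0

theorem boxTerm_coe (S : Matrix (StarIdx d → Fin k) (StarIdx d → Fin k) ℂ) (L : ℕ) (x : box d L) :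
    boxTerm S x.1 L = localTerm S L x := by
  rw [boxTerm, dif_pos x.2]

theorem sum_smul_reservoirH (p : Site d → Fin ℓ)
    (S : Matrix (StarIdx d → Fin k) (StarIdx d → Fin k) ℂ) (α : Fin ℓ → ℂ) (L : ℕ) :
    ∑ j, α j • reservoirH p S L j = ham S (reservoirCoeff p α) L := by
  simp only [ham, reservoirH, ← Finset.sum_coe_sort (box d L), boxTerm_coe, Finset.smul_sum]
  rw [Finset.sum_comm]
  refine Finset.sum_congr rfl fun x _ => ?_
  by_cases hx : x.1 ∈ boundary p
  · simp [reservoirCoeff, hx]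
  · simp [reservoirCoeff, hx]

theorem interaction_eq_ham (p : Site d → Fin ℓ)
    (S : Matrix (StarIdx d → Fin k) (StarIdx d → Fin k) ℂ) (J : Site d → ℝ) (L : ℕ) :
    interaction p S J L = ham S (interactionCoeff p J) L := by
  simp only [ham, interaction, ← Finset.sum_coe_sort (box d L), boxTerm_coe]
  refine Finset.sum_congr rfl fun x _ => ?_
  by_cases hx : x.1 ∈ boundary p
  · simp [interactionCoeff, hx]
  · simp [interactionCoeff, hx]

theorem norm_reservoirCoeff_le (p : Site d → Fin ℓ) {α : Fin ℓ → ℂ} {C : ℝ}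
    (hC : ∀ j, ‖α j‖ ≤ C) (x : Site d) : ‖reservoirCoeff p α x‖ ≤ C := by
  rw [reservoirCoeff]
  split_ifs
  · rw [norm_zero]
    exact (norm_nonneg _).trans (hC (p x))
  · exact hC _

theorem star_reservoirCoeff (p : Site d → Fin ℓ) (a : Fin ℓ → ℝ) (x : Site d) :
    star (reservoirCoeff p (fun j => Complex.I * (a j : ℂ)) x) =
      -reservoirCoeff p (fun j => Complex.I * (a j : ℂ)) x := by
  rw [reservoirCoeff]
  split_ifs <;> simp

theorem summable_norm_interactionCoeff {p : Site d → Fin ℓ} {J : Site d → ℝ}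
    (hJ : Summable fun x : boundary p => |J x|) : Summable fun x => ‖interactionCoeff p J x‖ := by
  refine (summable_subtype_iff_indicator (f := fun x => |J x|).1 hJ).congr fun x => ?_
  by_cases hx : x ∈ boundary p <;> simp [interactionCoeff, hx]

/-- The cocycle `exp (i t H) exp (- i t H_0)` that relates the full and the free dynamics. -/
def cocycle (p : Site d → Fin ℓ) (J : Site d → ℝ)
    (S : Matrix (StarIdx d → Fin k) (StarIdx d → Fin k) ℂ) (t : ℝ) (L : ℕ) :
    Matrix (Config d k L) (Config d k L) ℂ :=
  exp (ham S (reservoirCoeff p (fun _ => Complex.I * (t : ℂ)) +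
      (Complex.I * (t : ℂ)) • interactionCoeff p J) L) *
    exp (-ham S (reservoirCoeff p (fun _ => Complex.I * (t : ℂ))) L)

theorem locallyGenerated_cocycle {p : Site d → Fin ℓ} {J : Site d → ℝ}
    {S : Matrix (StarIdx d → Fin k) (StarIdx d → Fin k) ℂ} (hS : S.IsHermitian)
    (hJ : Summable fun x : boundary p => |J x|) (t : ℝ) :
    LocallyGenerated S (cocycle p J S t) := by
  refine LocallyGenerated.exp_mul_exp hS (star_reservoirCoeff p fun _ => t)
    (norm_reservoirCoeff_le p (C := |t|) fun _ => by simp) (abs_nonneg t) ?_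
  simp only [Pi.smul_apply, smul_eq_mul, norm_mul]
  exact (summable_norm_interactionCoeff hJ).mul_left _

variable [NeZero k] (p : Site d → Fin ℓ) {S : Matrix (StarIdx d → Fin k) (StarIdx d → Fin k) ℂ}
  (hS : S.IsHermitian) (J : Site d → ℝ) (β : Fin ℓ → ℝ)

theorem spinSystem_lc (α : Fin ℓ → ℂ) (L : ℕ) :
    (spinSystem p S hS J β L).lc α = ham S (reservoirCoeff p α) L :=
  sum_smul_reservoirH p S α L

theorem spinSystem_U (t : ℝ) (L : ℕ) : (spinSystem p S hS J β L).U t =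
    exp (ham S (reservoirCoeff p (fun _ => Complex.I * (t : ℂ)) +
      (Complex.I * (t : ℂ)) • interactionCoeff p J) L) := by
  have h : ∑ j, (spinSystem p S hS J β L).E j = ∑ j, (1 : ℂ) • reservoirH p S L j := by
    simp only [one_smul]
    rfl
  have h2 : reservoirCoeff p (fun _ => Complex.I * (t : ℂ)) =
      (Complex.I * (t : ℂ)) • reservoirCoeff p (fun _ => 1) := by
    ext x
    by_cases hx : x ∈ boundary p <;> simp [reservoirCoeff, hx]
  rw [ConfinedMultisystem.U, ConfinedMultisystem.H, h, sum_smul_reservoirH p S (fun _ => 1),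
    ham_add, h2, ham_smul, ham_smul, ← smul_add, ← interaction_eq_ham]
  rfl

/-- The Gibbs state is a multiple of the exponential of `-β·E`, hence a function of the measured
energies. -/
theorem commute_spinSystem_ρ_proj (L : ℕ) (e : Fin ℓ → ℝ) :
    Commute (spinSystem p S hS J β L).ρ ((spinSystem p S hS J β L).proj e) := by
  have h := (spinSystem p S hS J β L).commute_exp_lc_proj (fun j => -(β j : ℂ)) e
  rw [ConfinedMultisystem.lc] at h
  simp only [neg_smul, Finset.sum_neg_distrib] at h
  exact h.smul_left _

theorem spinSystem_χ_eq_trace (t : ℝ) (a : Fin ℓ → ℝ) (L : ℕ) :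
    (spinSystem p S hS J β L).χ t (fun j => Complex.I * (a j : ℂ)) =
      ((spinSystem p S hS J β L).ρ *
        (exp (ham S (reservoirCoeff p fun j => Complex.I * (a j : ℂ)) L) * cocycle p J S t L *
          exp (-ham S (reservoirCoeff p fun j => Complex.I * (a j : ℂ)) L) *
          star (cocycle p J S t L))).trace := by
  rw [(spinSystem p S hS J β L).χ_eq_trace_cocycle (commute_spinSystem_ρ_proj p hS J β L),
    spinSystem_lc, spinSystem_lc, spinSystem_U]
  rfl

theorem assumptionTL_spinSystem (hJ : Summable fun x : boundary p => |J x|)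
    (hconv : StatesConverge (spinSystem p S hS J β)) : AssumptionTL (spinSystem p S hS J β) := by
  have hG := locallyGenerated_cocycle hS hJ
  have hF : ∀ (t : ℝ) (a : Fin ℓ → ℝ), LocallyGenerated S fun L =>
      exp (ham S (reservoirCoeff p fun j => Complex.I * (a j : ℂ)) L) * cocycle p J S t L *
        exp (-ham S (reservoirCoeff p fun j => Complex.I * (a j : ℂ)) L) *
        star (cocycle p J S t L) := fun t a =>
    ((hG t).exp_conj hS (star_reservoirCoeff p a)
      (norm_reservoirCoeff_le p (C := ‖a‖) fun j => by simpa using norm_le_pi_norm a j)).mul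
      ((hG t).star_apply hS)
  choose χlim hχlim using fun t a => hconv (hF t a).toQuasiLocal
  have hlim : ∀ (t : ℝ) (a : Fin ℓ → ℝ), Filter.Tendsto
      (fun L => (spinSystem p S hS J β L).χ t fun j => Complex.I * (a j : ℂ)) Filter.atTop
        (𝓝 (χlim t a)) := fun t a => by
    simp only [spinSystem_χ_eq_trace]
    exact hχlim t a
  refine ⟨χlim, fun t _ a => hlim t a, fun t _ => ?_⟩
  rw [Metric.continuousAt_iff]
  intro ε hε
  obtain ⟨C, hC, hGC⟩ := ((hG t).star_apply hS).bounded
  obtain ⟨δ, hδ, h⟩ := (hG t).exp_conj_continuous hS (ε / (2 * C)) (by positivity)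
  refine ⟨δ, hδ, fun {a} ha => ?_⟩
  rw [dist_zero_right] at ha
  rw [dist_eq_norm]
  -- A bound by `ε / 2` holds in every volume, since `δ` does not depend on `L`, and passes to the
  -- limit. The difference of the traces is controlled by `‖e^K G e^{-K} - G‖ ‖G^*‖`.
  refine lt_of_le_of_lt (le_of_tendsto ((hlim t a).sub (hlim t 0)).norm
    (Filter.Eventually.of_forall fun L => ?_)) (half_lt_self hε)
  have h0 : ham S (reservoirCoeff p fun j => Complex.I * ((0 : Fin ℓ → ℝ) j : ℂ)) L = 0 := by
    have : (reservoirCoeff p fun j => Complex.I * ((0 : Fin ℓ → ℝ) j : ℂ)) = 0 := by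
      ext x
      simp [reservoirCoeff]
    rw [this]
    simp [ham]
  rw [spinSystem_χ_eq_trace, spinSystem_χ_eq_trace, h0, neg_zero, NormedSpace.exp_zero, one_mul,
    mul_one, ← Matrix.trace_sub, ← mul_sub, ← sub_mul]
  refine (norm_trace_mul_le (spinSystem p S hS J β L).ρ_posSemidef
    (spinSystem p S hS J β L).ρ_trace _).trans ((norm_mul_le _ _).trans ?_)
  have h1 := h _ (star_reservoirCoeff p a)
    (norm_reservoirCoeff_le p fun j => by simpa using (norm_le_pi_norm a j).trans ha.le) L
  calc _ ≤ ε / (2 * C) * C := mul_le_mul h1 (hGC L) (norm_nonneg _) (by positivity)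
    _ = ε / 2 := by field_simp

/-- Each boundary term is conjugated by a local Hamiltonian with coefficients at most `C`, the
factor `2` being offset by the `1 / 2` in the exponent; `J` makes the sum of the bounds finite. -/
theorem norm_deformedV_le (hJ : Summable fun x : boundary p => |J x|) {α : Fin ℓ → ℝ} {C : ℝ}
    (hα : ∀ j, |α j| ≤ 2 * C) (hC : rate S C < 1) (L : ℕ) :
    ‖(spinSystem p S hS J β L).deformedV α‖ ≤
      (∑' x, ‖interactionCoeff p J x‖) * (‖S‖ * (1 - rate S C)⁻¹) := by
  have hv := summable_norm_interactionCoeff hJ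
  have hpos : 0 < 1 - rate S C := by linarith
  set c := ((1 : ℂ) / 2) • reservoirCoeff p fun j => (α j : ℂ) with hc
  have hcC : ∀ x, ‖c x‖ ≤ C := fun x => by
    have h := norm_reservoirCoeff_le p (α := fun j => (α j : ℂ)) (fun j => by simpa using hα j) x
    rw [hc, Pi.smul_apply, smul_eq_mul, norm_mul]
    norm_num
    linarith
  have h1 : ((1 : ℂ) / 2) • ∑ j, (α j : ℂ) • (spinSystem p S hS J β L).E j = ham S c L := by
    rw [hc, ham_smul, ← sum_smul_reservoirH]
    rfl
  have h2 : (spinSystem p S hS J β L).V = ham S (interactionCoeff p J) L :=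
    interaction_eq_ham p S J L
  rw [ConfinedMultisystem.deformedV, h1, h2, ham.eq_1 S (interactionCoeff p J), Finset.mul_sum,
    Finset.sum_mul]
  calc _ ≤ ∑ x ∈ box d L, ‖interactionCoeff p J x‖ * (‖S‖ * (1 - rate S C)⁻¹) := by
        refine norm_sum_le_of_le _ fun x _ => ?_
        rw [mul_smul_comm, smul_mul_assoc, norm_smul]
        exact mul_le_mul_of_nonneg_left (norm_exp_ham_mul_boxTerm_le S hcC hC L x) (norm_nonneg _)
    _ ≤ _ := by
        rw [← Finset.sum_mul]
        gcongr
        exact hv.sum_le_tsum _ fun x _ => norm_nonneg _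

theorem assumptionB_spinSystem (hJ : Summable fun x : boundary p => |J x|) {α₀ θ₀ : ℝ}
    (hα₀ : 0 < α₀) (hθ₀ : α₀ ≤ θ₀) (h : rate S θ₀ < 1) :
    AssumptionB (spinSystem p S hS J β) α₀ θ₀ := by
  refine ⟨hα₀, hθ₀, lt_of_le_of_lt (iSup_le fun L => iSup₂_le fun θ hθ => iSup₂_le fun α hα =>
    ENNReal.ofReal_le_ofReal (norm_deformedV_le p hS J β hJ (fun j => ?_) h L))
    ENNReal.ofReal_lt_top⟩
  have h1 : |α j| ≤ ‖α‖ := norm_le_pi_norm α j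
  rw [Pi.add_apply]
  -- Here `|α_j + θ| ≤ α₀ + θ₀ ≤ 2 θ₀`, which is where `α₀ ≤ θ₀` is needed.
  linarith [abs_add_le (α j) θ, hα.2]

end SpinSystem

end

end OpenSpin


theorem mainTheorem11 (d k ℓ : ℕ) [NeZero k]
    (p : OpenSpin.Site d → Fin ℓ) (hp : ∀ j, (p ⁻¹' {j}).Infinite)
    (S : Matrix (OpenSpin.StarIdx d → Fin k) (OpenSpin.StarIdx d → Fin k) ℂ)
    (hS : S.IsHermitian)
    (J : OpenSpin.Site d → ℝ) (hJ : Summable fun x : OpenSpin.boundary p => |J x|)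
    (β : Fin ℓ → ℝ) (hβ : ∀ j, 0 < β j)
    (hconv : OpenSpin.StatesConverge (OpenSpin.spinSystem p S hS J β)) :
    OpenSpin.AssumptionTL (OpenSpin.spinSystem p S hS J β) ∧
      ∃ γ : ℝ, 0 < γ ∧ ∀ α₀ θ₀ : ℝ, 0 < α₀ → α₀ ≤ θ₀ → θ₀ < γ →
        OpenSpin.AssumptionB (OpenSpin.spinSystem p S hS J β) α₀ θ₀ := by
  have h0 := OpenSpin.rate_nonneg S zero_le_one
  -- The rate is linear, so `rate S θ₀ < 1` amounts to `θ₀ * rate S 1 < 1`; the added `1` keeps the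
  -- inverse positive when `rate S 1 = 0`.
  refine ⟨OpenSpin.assumptionTL_spinSystem p hS J β hJ hconv, (OpenSpin.rate S 1 + 1)⁻¹,
    by positivity, fun α₀ θ₀ hα₀ hθ₀ hγ =>
      OpenSpin.assumptionB_spinSystem p hS J β hJ hα₀ hθ₀ ?_⟩
  rw [← mul_one θ₀, OpenSpin.rate_mul]
  rw [lt_inv_comm₀ (hα₀.trans_le hθ₀) (by positivity), ← one_div,
    lt_div_iff₀ (hα₀.trans_le hθ₀)] at hγ
  nlinarith
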